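/- \textbf{Setting.} Let $R_1,R_2,\dots$ be independent copies of a non-negative random variable $R$ with $\mathbb{E}R^2=1$. For every $d\in\mathbb{N}$ let $U_1^{(d)},U_2^{(d)},\dots$ be i.i.d.\ random vectors uniformly distributed on the unit sphere of $\mathbb{R}^d$, such that the sequences $(R_i)_{i\ge1}$ and $(U_i^{(d)})_{i\ge1}$ are independent. Put $$S_m^{(d)}=\sum_{i=1}^m R_iU_i^{(d)},\qquad m\in\mathbb{N}_0,$$ and let $\|\cdot\|$ be the Euclidean norm. Let $n=n(d)$ be a sequence of positive integers with $n(d)\to\infty$ as $d\to\infty$. Let $\overset{w}{\longrightarrow}$ denote convergence in distribution and $\mathrm{N}(0,1)$ the standard normal law. \textbf{Theorem.} Let $\alpha\in(1,2)$, let $L$ be a function that is slowly varying at infinity (measurable, eventually positive, $L(cx)/L(x)\to1$ as $x\to\infty$ for every $c>0$), and let $\zeta_\alpha$ be a zero-mean random variable with a spectrally positive $\alpha$-stable distribution, i.e.\ for some $\sigma>0$, $$\mathbb{E}\,e^{it\zeta_\alpha}=\exp\Big(-\sigma^\alpha|t|^\alpha\big(1-i\,\mathrm{sgn}(t)\tan\tfrac{\pi\alpha}{2}\big)\Big),\qquad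 t\in\mathbb{R}.$$ Suppose that $R^2$ is in the domain of attraction of $\zeta_\alpha$ in the sense that $$\frac{R_1^2+\dots+R_m^2-m}{m^{1/\alpha}L(m)}\overset{w}{\longrightarrow}\zeta_\alpha\qquad(m\to\infty).$$ (a) If there is $\delta>0$ such that $n(d)>d^{\frac{\alpha}{2\alpha-2}+\delta}$ for all sufficiently large $d$, then $$\frac{\|S_n^{(d)}\|^2-n}{\sqrt{2n^2/d}}\overset{w}{\longrightarrow}\mathrm{N}(0,1)\qquad(d\to\infty).$$ (b) If there is $\delta>0$ such that $n(d)<d^{\frac{\alpha}{2\alpha-2}-\delta}$ for all sufficiently large $d$, then $$\frac{\|S_n^{(d)}\|^2-n}{n^{1/\alpha}L(n)}\overset{w}{\longrightarrow}\zeta_\alpha\qquad(d\to\infty).$$ -/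

import Mathlib

open MeasureTheory ProbabilityTheory Filter Topology

/-- The uniform distribution on the unit sphere of `ℝ^d` (`d ≥ 1`), as a measure on `ℝ^d`:
the surface measure of the sphere, normalized to total mass one. -/
noncomputable def uniformUnitSphere (d : ℕ) : Measure (EuclideanSpace ℝ (Fin d)) :=
  (((volume : Measure (EuclideanSpace ℝ (Fin d))).toSphere Set.univ)⁻¹ •
    (volume : Measure (EuclideanSpace ℝ (Fin d))).toSphere).map Subtype.val

/-- `L` is slowly varying at infinity: measurable, eventually positive, and
`L (c x) / L x → 1` as `x → ∞`, for every `c > 0`. -/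
structure IsSlowlyVarying (L : ℝ → ℝ) : Prop where
  measurable : Measurable L
  eventually_pos : ∀ᶠ x in atTop, 0 < L x
  tendsto_ratio : ∀ c : ℝ, 0 < c → Tendsto (fun x : ℝ => L (c * x) / L x) atTop (𝓝 1)

/-- `ν` is the (nondegenerate) `α`-stable law, `α ≠ 1`, with scale `σ`, skewness `β` and
location `m`: its characteristic function is
`t ↦ exp (i m t - σ^α |t|^α (1 - i β sgn(t) tan (π α / 2)))`. -/
structure IsStableLaw (α σ β m : ℝ) (ν : Measure ℝ) : Prop where
  scale_pos : 0 < σ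
  skewness_mem : β ∈ Set.Icc (-1 : ℝ) 1
  charFun_eq : ∀ t : ℝ, charFun ν t =
    Complex.exp (Complex.I * (m * t : ℝ) - (σ ^ α * |t| ^ α : ℝ) *
      (1 - Complex.I * (β * SignType.sign t * Real.tan (Real.pi * α / 2) : ℝ)))

/-- `ν` is a spectrally positive `α`-stable law, that is, `α`-stable and totally skewed to the
right (skewness `1`), so that its Lévy measure is carried by `(0, ∞)`. -/
def IsSpectrallyPositiveStable (α : ℝ) (ν : Measure ℝ) : Prop :=
  ∃ σ m : ℝ, IsStableLaw α σ 1 m ν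

/-- The random walks with rotationally invariant increments `R i • U d i` in `ℝ^d`, `d ≥ 1`:
the radial parts `R i` are i.i.d., non-negative, with second moment one and do not depend on `d`;
for each `d` the directions `U d i` are i.i.d. uniform on the unit sphere of `ℝ^d`, and the
sequence of directions is independent of the sequence of radial parts. -/
structure IsRotationInvariantModel {Ω : Type*} [MeasurableSpace Ω] (P : Measure Ω)
    (R : ℕ → Ω → ℝ) (U : (d : ℕ) → ℕ → Ω → EuclideanSpace ℝ (Fin d)) : Prop where
  measurable_radial : ∀ i, Measurable (R i)
  radial_nonneg : ∀ i, ∀ᵐ ω ∂P, 0 ≤ R i ω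
  radial_identDistrib : ∀ i, IdentDistrib (R i) (R 0) P P
  radial_iIndep : iIndepFun R P
  radial_second_moment : ∫ ω, (R 0 ω) ^ 2 ∂P = 1
  measurable_direction : ∀ d, 0 < d → ∀ i, Measurable (U d i)
  direction_uniform : ∀ d, 0 < d → ∀ i, P.map (U d i) = uniformUnitSphere d
  direction_iIndep : ∀ d, 0 < d → iIndepFun (U d) P
  radial_indep_direction : ∀ d, 0 < d →
    IndepFun (fun ω (i : ℕ) => R i ω) (fun ω (i : ℕ) => U d i ω) P

/-- The position `S_m^{(d)}` of the `d`-dimensional walk after `m` steps. -/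
noncomputable def walk {Ω : Type*} (R : ℕ → Ω → ℝ)
    (U : (d : ℕ) → ℕ → Ω → EuclideanSpace ℝ (Fin d)) (d m : ℕ) (ω : Ω) :
    EuclideanSpace ℝ (Fin d) :=
  ∑ i ∈ Finset.range m, R i ω • U d i ω

/-!
Conditionally on the radial parts, `‖S_n‖² - n` splits into the diagonal `∑ R_i² - n`, governed by
the attraction hypothesis, and the off-diagonal part `∑_{i ≠ j} R_i R_j ⟪U_i, U_j⟫`. Write
`U_i = g_i / ‖g_i‖` with `g_i` standard Gaussian in `ℝ^d`. As `‖g_i‖² ≈ d`, the off-diagonal part is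
`L²`-close to `1 / d` times the same form in the `g_i`. Since `∑ R_i g_i` has the law of
`(∑ R_i²)^{1/2} g`, that form is a centred chi-square variable up to a negligible diagonal, so by
the central limit theorem the off-diagonal part is asymptotically normal on the scale `n √(2 / d)`.
Potter-type bounds for `L` decide which of the scales `n √(2 / d)` and `n^{1/α} L(n)` dominates.
-/

open scoped ENNReal RealInnerProductSpace

section GaussianReal

lemma integral_abs_rpow_gaussianReal {s : ℝ} (hs : -1 < s) :
    ∫ x, |x| ^ s ∂(gaussianReal 0 1) = 2 ^ (s / 2) * Real.Gamma ((s + 1) / 2) / √Real.pi := by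
  have hdensity (x : ℝ) : gaussianPDFReal 0 1 x • |x| ^ s =
      (√(2 * Real.pi))⁻¹ * (|x| ^ s * Real.exp (-(1 / 2) * |x| ^ (2 : ℝ))) := by
    rw [Real.rpow_two, sq_abs, gaussianPDFReal, smul_eq_mul, NNReal.coe_one, sub_zero,
      mul_one, mul_one, show -x ^ 2 / 2 = -(1 / 2) * x ^ 2 by ring]
    ring
  have hpow : (1 / 2 : ℝ) ^ (-(s + 1) / 2) = 2 ^ (s / 2) * √2 := by
    rw [one_div, Real.inv_rpow two_pos.le, ← Real.rpow_neg two_pos.le, Real.sqrt_eq_rpow,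
      ← Real.rpow_add two_pos]
    congr 1; ring
  simp_rw [integral_gaussianReal_eq_integral_smul one_ne_zero, hdensity]
  rw [integral_const_mul,
    integral_comp_abs (f := fun y : ℝ => y ^ s * Real.exp (-(1 / 2) * y ^ (2 : ℝ))),
    integral_rpow_mul_exp_neg_mul_rpow two_pos hs (by norm_num), hpow, Real.sqrt_mul two_pos.le]
  field_simp

lemma integral_sq_gaussianReal : ∫ x, x ^ 2 ∂(gaussianReal 0 1) = 1 := by
  have h := variance_of_integral_eq_zero (X := id) (by fun_prop)
    (integral_id_gaussianReal (μ := 0) (v := 1))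
  simpa using! h.symm

lemma integral_pow_four_gaussianReal : ∫ x, x ^ 4 ∂(gaussianReal 0 1) = 3 := by
  have habs (x : ℝ) : x ^ 4 = |x| ^ (4 : ℝ) := by
    rw [← Even.pow_abs (by decide) x, ← Real.rpow_natCast, Nat.cast_ofNat]
  have hGamma : Real.Gamma ((4 + 1) / 2) = 3 / 4 * √Real.pi := by
    have h := Real.Gamma_nat_add_half 2
    norm_num [Nat.doubleFactorial] at h ⊢
    linarith
  simp_rw [habs]
  rw [integral_abs_rpow_gaussianReal (by norm_num), hGamma,
    show (4 / 2 : ℝ) = 2 by norm_num, Real.rpow_two]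
  field_simp
  norm_num

lemma memLp_sq_gaussianReal : MemLp (fun x : ℝ => x ^ 2) 2 (gaussianReal 0 1) := by
  have h : MemLp id ((4 : ℕ) : ℝ≥0∞) (gaussianReal 0 1) := memLp_id_gaussianReal' _ (by simp)
  rw [memLp_two_iff_integrable_sq (by fun_prop)]
  refine h.integrable_norm_pow'.congr (ae_of_all _ fun x => ?_)
  simp only [id_eq, Real.norm_eq_abs, Even.pow_abs (by decide : Even 4)]
  ring

lemma variance_sq_gaussianReal : Var[fun x : ℝ => x ^ 2; gaussianReal 0 1] = 2 := by
  rw [variance_eq_sub memLp_sq_gaussianReal, integral_sq_gaussianReal]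
  simp only [Pi.pow_apply, ← pow_mul]
  rw [integral_pow_four_gaussianReal]
  norm_num

end GaussianReal

section NormStdGaussian

variable {E : Type*} [NormedAddCommGroup E] [InnerProductSpace ℝ E] [FiniteDimensional ℝ E]
  [MeasurableSpace E] [BorelSpace E]

lemma identDistrib_norm_sq_stdGaussian :
    IdentDistrib (fun x : E => ‖x‖ ^ 2) (fun y : Fin (Module.finrank ℝ E) → ℝ => ∑ i, y i ^ 2)
      (stdGaussian E) (Measure.pi fun _ => gaussianReal 0 1) := by
  refine ⟨by fun_prop, (by fun_prop : Measurable _).aemeasurable, ?_⟩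
  let b := stdOrthonormalBasis ℝ E
  rw [stdGaussian_eq_map_pi_orthonormalBasis b, Measure.map_map (by fun_prop) (by fun_prop)]
  congr 1
  ext y
  simp [← b.sum_sq_inner_right, inner_sum, real_inner_smul_right, b.inner_eq_ite]

lemma memLp_norm_sq_stdGaussian : MemLp (fun x : E => ‖x‖ ^ 2) 2 (stdGaussian E) := by
  rw [identDistrib_norm_sq_stdGaussian.memLp_iff]
  exact memLp_finsetSum _ fun i _ =>
    memLp_sq_gaussianReal.comp_measurePreserving
      (measurePreserving_eval (fun _ : Fin (Module.finrank ℝ E) => gaussianReal 0 1) i)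

lemma integral_norm_sq_stdGaussian :
    ∫ x, ‖x‖ ^ 2 ∂(stdGaussian E) = Module.finrank ℝ E := by
  have heval (i : Fin (Module.finrank ℝ E)) :
      ∫ y : Fin (Module.finrank ℝ E) → ℝ, y i ^ 2 ∂(Measure.pi fun _ => gaussianReal 0 1) = 1 := by
    rw [integral_comp_eval (μ := fun _ => gaussianReal 0 1) (f := fun x : ℝ => x ^ 2)
      (by fun_prop), integral_sq_gaussianReal]
  rw [identDistrib_norm_sq_stdGaussian.integral_eq, integral_finsetSum]
  · simp [heval]
  · exact fun i _ => integrable_comp_eval (μ := fun _ => gaussianReal 0 1)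
      (memLp_sq_gaussianReal.integrable one_le_two)

lemma variance_norm_sq_stdGaussian :
    Var[fun x => ‖x‖ ^ 2; stdGaussian E] = 2 * Module.finrank ℝ E := by
  rw [identDistrib_norm_sq_stdGaussian.variance_eq]
  have h := variance_sum_pi (μ := fun _ : Fin (Module.finrank ℝ E) => gaussianReal 0 1)
    (X := fun _ x => x ^ 2) fun _ => memLp_sq_gaussianReal
  simpa [variance_sq_gaussianReal, Finset.sum_fn, mul_comm] using! h

lemma integrable_norm_stdGaussian : Integrable (fun x : E => ‖x‖) (stdGaussian E) :=
  IsGaussian.integrable_id.norm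

lemma memLp_norm_stdGaussian : MemLp (fun x : E => ‖x‖) 2 (stdGaussian E) :=
  IsGaussian.memLp_two_id.norm

lemma variance_norm_stdGaussian_le : Var[fun x => ‖x‖; stdGaussian E] ≤ 2 := by
  rcases (Module.finrank ℝ E).eq_zero_or_pos with hE | hE
  · have := Module.finrank_zero_iff.1 hE
    have hnorm : (fun x : E => ‖x‖) = fun _ => 0 := by
      ext x; simp [Subsingleton.elim x 0]
    exact hnorm ▸ (variance_zero _).trans_le zero_le_two
  set d : ℝ := (Module.finrank ℝ E : ℝ) with hd
  have hd0 : 0 < d := by simpa [hd] using hE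
  -- `‖x‖² - d = (‖x‖ - √d) (‖x‖ + √d)` and the second factor is at least `√d`.
  have hpointwise (x : E) : (‖x‖ - √d) ^ 2 ≤ (‖x‖ ^ 2 - d) ^ 2 / d := by
    have hsq : √d ^ 2 = d := Real.sq_sqrt hd0.le
    have hfactor : d ≤ (‖x‖ + √d) ^ 2 := by
      nlinarith [norm_nonneg x, Real.sqrt_nonneg d]
    calc (‖x‖ - √d) ^ 2 ≤ (‖x‖ - √d) ^ 2 * (‖x‖ + √d) ^ 2 / d := by
          rw [le_div_iff₀ hd0]; gcongr
      _ = (‖x‖ ^ 2 - √d ^ 2) ^ 2 / d := by ring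
      _ = (‖x‖ ^ 2 - d) ^ 2 / d := by rw [hsq]
  calc Var[fun x => ‖x‖; stdGaussian E]
      = Var[fun x => ‖x‖ - √d; stdGaussian E] := (variance_sub_const (by fun_prop) _).symm
    _ ≤ ∫ x, (‖x‖ - √d) ^ 2 ∂(stdGaussian E) := variance_le_expectation_sq (by fun_prop)
    _ ≤ ∫ x, (‖x‖ ^ 2 - d) ^ 2 / d ∂(stdGaussian E) :=
        integral_mono (memLp_norm_stdGaussian.sub (memLp_const _)).integrable_sq
          ((memLp_norm_sq_stdGaussian.sub (memLp_const _)).integrable_sq.div_const _) hpointwise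
    _ = 2 := by
        rw [integral_div, hd, ← integral_norm_sq_stdGaussian, ← variance_eq_integral (by fun_prop),
          variance_norm_sq_stdGaussian, integral_norm_sq_stdGaussian, ← hd]
        field_simp

lemma finrank_sub_sq_integral_norm_stdGaussian_le :
    Module.finrank ℝ E - (∫ x, ‖x‖ ∂(stdGaussian E)) ^ 2 ≤ 2 := by
  have h := variance_eq_sub (memLp_norm_stdGaussian (E := E))
  simp only [Pi.pow_apply, integral_norm_sq_stdGaussian] at h
  exact h ▸ variance_norm_stdGaussian_le

end NormStdGaussian

/-- The direction `x / ‖x‖` of a vector, with junk value `0` at the zero vector. -/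
noncomputable def unitDirection {E : Type*} [NormedAddCommGroup E] [NormedSpace ℝ E] (x : E) : E :=
  ‖x‖⁻¹ • x

section UnitDirection

variable {E : Type*} [NormedAddCommGroup E] [NormedSpace ℝ E]

lemma norm_unitDirection {x : E} (hx : x ≠ 0) : ‖unitDirection x‖ = 1 := by
  simp [unitDirection, norm_smul, hx]

lemma norm_unitDirection_le_one (x : E) : ‖unitDirection x‖ ≤ 1 := by
  rcases eq_or_ne x 0 with rfl | hx
  · simp [unitDirection]
  · exact (norm_unitDirection hx).le

lemma unitDirection_neg (x : E) : unitDirection (-x) = -unitDirection x := by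
  simp [unitDirection]

lemma norm_smul_unitDirection (x : E) : ‖x‖ • unitDirection x = x := by
  rcases eq_or_ne x 0 with rfl | hx
  · simp
  · simp [unitDirection, hx]

@[fun_prop]
lemma measurable_unitDirection [MeasurableSpace E] [BorelSpace E] [SecondCountableTopology E] :
    Measurable (unitDirection : E → E) := by
  unfold unitDirection; fun_prop

end UnitDirection

section InnerUnitDirection

variable {E : Type*} [NormedAddCommGroup E] [InnerProductSpace ℝ E]

lemma inner_unitDirection_sq_le_one (x y : E) : ⟪unitDirection x, unitDirection y⟫ ^ 2 ≤ 1 := by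
  rw [sq_le_one_iff_abs_le_one]
  exact (abs_real_inner_le_norm _ _).trans
    (mul_le_one₀ (norm_unitDirection_le_one _) (norm_nonneg _) (norm_unitDirection_le_one _))

lemma inner_eq_norm_mul_norm_mul_inner_unitDirection (x y : E) :
    ⟪x, y⟫ = ‖x‖ * ‖y‖ * ⟪unitDirection x, unitDirection y⟫ := by
  conv_lhs => rw [← norm_smul_unitDirection x, ← norm_smul_unitDirection y]
  rw [real_inner_smul_left, real_inner_smul_right, mul_assoc]

end InnerUnitDirection

section Polar

variable {E : Type*} [NormedAddCommGroup E] [InnerProductSpace ℝ E] [FiniteDimensional ℝ E]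
  [MeasurableSpace E] [BorelSpace E]

lemma integrable_exp_neg_norm_sq : Integrable fun x : E => Real.exp (-(1 / 2) * ‖x‖ ^ 2) := by
  refine (GaussianFourier.integrable_cexp_neg_mul_sq_norm_add (V := E) (b := 1 / 2)
    (by norm_num) 0 0).norm.congr (ae_of_all _ fun x => ?_)
  simp [Complex.norm_exp, ← Complex.ofReal_pow]

lemma stdGaussian_eq_withDensity :
    stdGaussian E = volume.withDensity (fun x : E => ENNReal.ofReal
      ((2 * Real.pi) ^ (-(Module.finrank ℝ E / 2 : ℝ)) * Real.exp (-(1 / 2) * ‖x‖ ^ 2))) := by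
  set c : ℝ := (2 * Real.pi) ^ (-(Module.finrank ℝ E / 2 : ℝ)) with hc
  have : IsFiniteMeasure (volume.withDensity (fun x : E => ENNReal.ofReal
      (c * Real.exp (-(1 / 2) * ‖x‖ ^ 2)))) :=
    isFiniteMeasure_withDensity_ofReal (integrable_exp_neg_norm_sq.const_mul c).2
  refine Measure.ext_of_charFun (funext fun t => ?_)
  have hintegrand (x : E) : (ENNReal.ofReal (c * Real.exp (-(1 / 2) * ‖x‖ ^ 2))).toReal •
      Complex.exp (⟪x, t⟫ * Complex.I) =
      (c : ℂ) * Complex.exp (-(1 / 2) * ‖x‖ ^ 2 + Complex.I * ⟪t, x⟫) := by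
    rw [ENNReal.toReal_ofReal (by positivity), Complex.exp_add, real_inner_comm, Complex.real_smul]
    push_cast
    ring_nf
  have hnormalization : ((Real.pi : ℂ) / (1 / 2)) ^ (Module.finrank ℝ E / 2 : ℂ) =
      (((2 * Real.pi) ^ (Module.finrank ℝ E / 2 : ℝ) : ℝ) : ℂ) := by
    rw [Complex.ofReal_cpow (by positivity)]
    push_cast
    congr 1
    ring
  rw [charFun_stdGaussian, charFun_apply,
    integral_withDensity_eq_integral_toReal_smul (by fun_prop) (by simp)]
  simp_rw [hintegrand]
  rw [integral_const_mul, GaussianFourier.integral_cexp_neg_mul_sq_norm_add (by norm_num),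
    hnormalization, ← mul_assoc, ← Complex.ofReal_mul, hc, ← Real.rpow_add (by positivity),
    neg_add_cancel, Real.rpow_zero, Complex.ofReal_one, one_mul, Complex.I_sq]
  ring_nf

lemma withDensity_norm_map_unitDirection_norm_prod [Nontrivial E] (μ : Measure E)
    [μ.IsAddHaarMeasure] {ρ : ℝ → ℝ≥0∞} (hρ : Measurable ρ) {s : Set E} {t : Set ℝ}
    (hs : MeasurableSet s) (ht : MeasurableSet t) :
    (μ.withDensity (fun x => ρ ‖x‖)).map (fun x => (unitDirection x, ‖x‖)) (s ×ˢ t) =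
      μ.toSphere (Subtype.val ⁻¹' s) *
        ∫⁻ r, t.indicator ρ (r : ℝ) ∂(Measure.volumeIoiPow (Module.finrank ℝ E - 1)) := by
  let sphereIndicator : Metric.sphere (0 : E) 1 → ℝ≥0∞ := (Subtype.val ⁻¹' s).indicator fun _ => 1
  let radialDensity : Set.Ioi (0 : ℝ) → ℝ≥0∞ := fun r => t.indicator ρ r
  have hpolar (x : ({0}ᶜ : Set E)) :
      ((fun x : E => (unitDirection x, ‖x‖)) ⁻¹' s ×ˢ t).indicator (fun x => ρ ‖x‖) (x : E) =
        sphereIndicator (homeomorphUnitSphereProd E x).1 *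
          radialDensity (homeomorphUnitSphereProd E x).2 := by
    have hdir : ((homeomorphUnitSphereProd E x).1 : E) = unitDirection (x : E) := by
      simp [unitDirection]
    by_cases hxs : unitDirection (x : E) ∈ s <;> by_cases hxt : ‖(x : E)‖ ∈ t <;>
      simp [sphereIndicator, radialDensity, Set.indicator, hdir, hxs, hxt]
  rw [Measure.map_apply (by fun_prop) (hs.prod ht),
    withDensity_apply _ ((hs.prod ht).preimage (by fun_prop)),
    ← lintegral_indicator ((hs.prod ht).preimage (by fun_prop)),
    ← lintegral_add_compl _ (measurableSet_singleton (0 : E)),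
    setLIntegral_measure_zero {(0 : E)} _ (by simp), zero_add,
    ← lintegral_subtype_comap (measurableSet_singleton (0 : E)).compl]
  simp_rw [hpolar]
  rw [(Measure.measurePreserving_homeomorphUnitSphereProd μ).lintegral_comp_emb
    (Homeomorph.measurableEmbedding _) (fun p => sphereIndicator p.1 * radialDensity p.2),
    lintegral_prod_mul (f := sphereIndicator) (g := radialDensity)
      (measurable_const.indicator (hs.preimage measurable_subtype_coe)).aemeasurable
      ((hρ.indicator ht).comp measurable_subtype_coe).aemeasurable,
    lintegral_indicator_const (hs.preimage measurable_subtype_coe), one_mul]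

lemma withDensity_norm_map_unitDirection_norm [Nontrivial E] (μ : Measure E) [μ.IsAddHaarMeasure]
    {ρ : ℝ → ℝ≥0∞} (hρ : Measurable ρ) [IsFiniteMeasure (μ.withDensity fun x => ρ ‖x‖)] :
    (μ.withDensity (fun x => ρ ‖x‖)).map (fun x => (unitDirection x, ‖x‖)) =
      (((μ.toSphere Set.univ)⁻¹ • μ.toSphere).map Subtype.val).prod
        ((μ.withDensity fun x => ρ ‖x‖).map norm) := by
  have hprod := fun (s : Set E) (t : Set ℝ) hs ht =>
    withDensity_norm_map_unitDirection_norm_prod μ hρ (s := s) (t := t) hs ht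
  have hτ : μ.toSphere Set.univ ≠ 0 := Measure.measure_univ_ne_zero.2 (Measure.toSphere_ne_zero _)
  have hnorm (t : Set ℝ) (ht : MeasurableSet t) : (μ.withDensity fun x => ρ ‖x‖).map norm t =
      μ.toSphere Set.univ *
        ∫⁻ r, t.indicator ρ (r : ℝ) ∂(Measure.volumeIoiPow (Module.finrank ℝ E - 1)) := by
    rw [← Set.preimage_univ (f := Subtype.val), ← hprod Set.univ t .univ ht,
      Measure.map_apply (by fun_prop) ht, Measure.map_apply (by fun_prop) (.prod .univ ht)]
    congr 1
    ext x; simp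
  refine (Measure.prod_eq fun s t hs ht => ?_).symm
  rw [hprod s t hs ht, hnorm t ht, Measure.map_apply measurable_subtype_coe hs,
    Measure.smul_apply, smul_eq_mul, mul_comm (μ.toSphere Set.univ)⁻¹, mul_assoc,
    ← mul_assoc (μ.toSphere Set.univ)⁻¹, ENNReal.inv_mul_cancel hτ (measure_ne_top _ _), one_mul]

lemma stdGaussian_map_unitDirection_norm [Nontrivial E] :
    (stdGaussian E).map (fun x => (unitDirection x, ‖x‖)) =
      ((((volume : Measure E).toSphere Set.univ)⁻¹ • (volume : Measure E).toSphere).map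
        Subtype.val).prod ((stdGaussian E).map norm) := by
  have hfinite : IsFiniteMeasure (stdGaussian E) := inferInstance
  rw [stdGaussian_eq_withDensity] at hfinite ⊢
  exact withDensity_norm_map_unitDirection_norm volume
    (ρ := fun r => ENNReal.ofReal (_ * Real.exp (-(1 / 2) * r ^ 2))) (by fun_prop)

lemma stdGaussian_map_unitDirection [Nontrivial E] :
    (stdGaussian E).map unitDirection =
      (((volume : Measure E).toSphere Set.univ)⁻¹ • (volume : Measure E).toSphere).map
        Subtype.val := by
  have : IsProbabilityMeasure ((stdGaussian E).map norm) :=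
    Measure.isProbabilityMeasure_map (by fun_prop)
  have h := congrArg Measure.fst (stdGaussian_map_unitDirection_norm (E := E))
  rwa [Measure.fst_prod, Measure.fst, Measure.map_map (by fun_prop) (by fun_prop)] at h

lemma indepFun_unitDirection_norm_stdGaussian [Nontrivial E] :
    IndepFun unitDirection norm (stdGaussian E) := by
  rw [indepFun_iff_map_prod_eq_prod_map_map (by fun_prop) (by fun_prop),
    stdGaussian_map_unitDirection, stdGaussian_map_unitDirection_norm]

lemma ae_norm_unitDirection_eq_one [Nontrivial E] :
    ∀ᵐ x ∂(stdGaussian E), ‖unitDirection x‖ = 1 := by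
  rw [stdGaussian_eq_withDensity]
  filter_upwards [(withDensity_absolutelyContinuous _ _).ae_le (Measure.ae_ne volume (0 : E))]
    with x hx using norm_unitDirection hx

lemma stdGaussian_map_unitDirection_eq_uniformUnitSphere {d : ℕ} (hd : 0 < d) :
    (stdGaussian (EuclideanSpace ℝ (Fin d))).map unitDirection = uniformUnitSphere d := by
  have : Nonempty (Fin d) := ⟨⟨0, hd⟩⟩
  have : Nontrivial (EuclideanSpace ℝ (Fin d)) := inferInstance
  exact stdGaussian_map_unitDirection

end Polar

section InnerProductMoments

variable {E : Type*} [NormedAddCommGroup E] [InnerProductSpace ℝ E] [FiniteDimensional ℝ E]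
  [MeasurableSpace E] [BorelSpace E]

lemma integral_inner_sq_stdGaussian (v : E) :
    ∫ x, ⟪x, v⟫ ^ 2 ∂(stdGaussian E) = ‖v‖ ^ 2 := by
  have h := variance_of_integral_eq_zero (by fun_prop)
    (integral_strongDual_stdGaussian (innerSL ℝ v))
  rw [variance_dual_stdGaussian] at h
  simpa [real_inner_comm] using h.symm

lemma memLp_norm_mul_norm_stdGaussian_prod :
    MemLp (fun z : E × E => ‖z.1‖ * ‖z.2‖) 2 ((stdGaussian E).prod (stdGaussian E)) := by
  have hnorm : Integrable (fun x : E => ‖x‖ ^ 2) (stdGaussian E) :=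
    memLp_norm_stdGaussian.integrable_sq
  rw [memLp_two_iff_integrable_sq (by fun_prop)]
  simpa only [mul_pow] using hnorm.mul_prod hnorm

lemma memLp_inner_stdGaussian_prod :
    MemLp (fun z : E × E => ⟪z.1, z.2⟫) 2 ((stdGaussian E).prod (stdGaussian E)) :=
  memLp_norm_mul_norm_stdGaussian_prod.mono (by fun_prop) (ae_of_all _ fun z => by
    simpa using abs_real_inner_le_norm z.1 z.2)

lemma memLp_inner_unitDirection_stdGaussian_prod :
    MemLp (fun z : E × E => ⟪unitDirection z.1, unitDirection z.2⟫) 2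
      ((stdGaussian E).prod (stdGaussian E)) :=
  MemLp.of_bound (by fun_prop) 1 (ae_of_all _ fun z => by
    simpa [← sq_le_one_iff_abs_le_one] using inner_unitDirection_sq_le_one z.1 z.2)

variable [Nontrivial E]

lemma integral_inner_unitDirection_sq_mul (v : E) {φ : ℝ → ℝ} (hφ : Measurable φ) :
    ∫ x, ⟪unitDirection x, v⟫ ^ 2 * φ ‖x‖ ∂(stdGaussian E) =
      ‖v‖ ^ 2 / Module.finrank ℝ E * ∫ x : E, φ ‖x‖ ∂(stdGaussian E) := by
  have hindep {ψ : ℝ → ℝ} (hψ : Measurable ψ) :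
      ∫ x, ⟪unitDirection x, v⟫ ^ 2 * ψ ‖x‖ ∂(stdGaussian E) =
        (∫ x, ⟪unitDirection x, v⟫ ^ 2 ∂(stdGaussian E)) * ∫ x : E, ψ ‖x‖ ∂(stdGaussian E) :=
    (indepFun_unitDirection_norm_stdGaussian.comp (φ := fun u : E => ⟪u, v⟫ ^ 2)
      (by fun_prop) hψ).integral_fun_mul_eq_mul_integral (by fun_prop)
        (hψ.comp measurable_norm).aestronglyMeasurable
  have hnorm (x : E) : ⟪unitDirection x, v⟫ ^ 2 * ‖x‖ ^ 2 = ⟪x, v⟫ ^ 2 := by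
    rw [← mul_pow, mul_comm, ← real_inner_smul_left, norm_smul_unitDirection]
  have hsq := hindep (ψ := fun r => r ^ 2) (by fun_prop)
  simp_rw [hnorm] at hsq
  rw [integral_inner_sq_stdGaussian, integral_norm_sq_stdGaussian] at hsq
  have hfinrank : (Module.finrank ℝ E : ℝ) ≠ 0 := mod_cast Module.finrank_pos.ne'
  rw [hindep hφ, hsq, mul_div_cancel_right₀ _ hfinrank]

lemma integral_inner_unitDirection_sq_mul_prod {φ : ℝ → ℝ → ℝ}
    (hφ : Measurable (Function.uncurry φ))
    (hint : Integrable (fun z : E × E => φ ‖z.1‖ ‖z.2‖) ((stdGaussian E).prod (stdGaussian E))) :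
    ∫ z : E × E, ⟪unitDirection z.1, unitDirection z.2⟫ ^ 2 * φ ‖z.1‖ ‖z.2‖
        ∂((stdGaussian E).prod (stdGaussian E)) =
      (∫ z : E × E, φ ‖z.1‖ ‖z.2‖ ∂((stdGaussian E).prod (stdGaussian E))) /
        Module.finrank ℝ E := by
  have hint' : Integrable (fun z : E × E =>
      ⟪unitDirection z.1, unitDirection z.2⟫ ^ 2 * φ ‖z.1‖ ‖z.2‖)
      ((stdGaussian E).prod (stdGaussian E)) :=
    hint.bdd_mul (c := 1) (by fun_prop) (ae_of_all _ fun z => by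
      simpa using inner_unitDirection_sq_le_one z.1 z.2)
  rw [integral_prod_symm _ hint', integral_prod_symm _ hint, ← integral_div]
  refine integral_congr_ae ?_
  filter_upwards [ae_norm_unitDirection_eq_one (E := E)] with y hy
  rw [integral_inner_unitDirection_sq_mul _ (φ := fun r => φ r ‖y‖)
    (hφ.comp measurable_prodMk_right), hy]
  ring

lemma integral_inner_unitDirection_sq_stdGaussian_prod :
    ∫ z : E × E, ⟪unitDirection z.1, unitDirection z.2⟫ ^ 2
      ∂((stdGaussian E).prod (stdGaussian E)) = 1 / Module.finrank ℝ E := by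
  simpa using integral_inner_unitDirection_sq_mul_prod (E := E) (φ := fun _ _ => 1)
    measurable_const (integrable_const _)

lemma integral_one_sub_norm_mul_norm_div_sq_le :
    ∫ z : E × E, (1 - ‖z.1‖ * ‖z.2‖ / (Module.finrank ℝ E : ℝ)) ^ 2
      ∂((stdGaussian E).prod (stdGaussian E)) ≤ 4 / (Module.finrank ℝ E : ℝ) := by
  set d : ℝ := (Module.finrank ℝ E : ℝ) with hd
  have hd0 : 0 < d := by simpa [hd] using Module.finrank_pos (R := ℝ) (M := E)
  have hnorm : Integrable (fun x : E => ‖x‖) (stdGaussian E) := integrable_norm_stdGaussian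
  have hnormsq : Integrable (fun x : E => ‖x‖ ^ 2) (stdGaussian E) :=
    memLp_norm_stdGaussian.integrable_sq
  have hprod := hnorm.mul_prod hnorm
  have hlinear : Integrable (fun z : E × E => 1 - 2 / d * (‖z.1‖ * ‖z.2‖))
      ((stdGaussian E).prod (stdGaussian E)) := (integrable_const 1).sub (hprod.const_mul _)
  have hexpand (z : E × E) : (1 - ‖z.1‖ * ‖z.2‖ / d) ^ 2 =
      1 - 2 / d * (‖z.1‖ * ‖z.2‖) + ‖z.1‖ ^ 2 * ‖z.2‖ ^ 2 / d ^ 2 := by ring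
  simp_rw [hexpand]
  rw [integral_add hlinear ((hnormsq.mul_prod hnormsq).div_const _),
    integral_sub (integrable_const _) (hprod.const_mul _), integral_const_mul,
    integral_div, integral_prod_mul (f := fun x : E => ‖x‖) (g := fun x : E => ‖x‖),
    integral_prod_mul (f := fun x : E => ‖x‖ ^ 2) (g := fun x : E => ‖x‖ ^ 2),
    integral_norm_sq_stdGaussian, ← hd, integral_const, probReal_univ, one_smul, ← sq]
  have h := finrank_sub_sq_integral_norm_stdGaussian_le (E := E)
  rw [← hd] at h
  calc _ = 2 * (d - (∫ x : E, ‖x‖ ∂(stdGaussian E)) ^ 2) / d := by field_simp; ring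
    _ ≤ 2 * 2 / d := by gcongr
    _ = 4 / d := by norm_num

lemma integral_inner_unitDirection_sub_inner_sq_le :
    ∫ z : E × E, (⟪unitDirection z.1, unitDirection z.2⟫ - ⟪z.1, z.2⟫ / Module.finrank ℝ E) ^ 2
      ∂((stdGaussian E).prod (stdGaussian E)) ≤ 4 / (Module.finrank ℝ E : ℝ) ^ 2 := by
  set d : ℝ := (Module.finrank ℝ E : ℝ)
  have hnorm : MemLp (fun z : E × E => 1 - ‖z.1‖ * ‖z.2‖ / d) 2
      ((stdGaussian E).prod (stdGaussian E)) :=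
    (memLp_const 1).sub (by
      simpa only [div_eq_mul_inv] using memLp_norm_mul_norm_stdGaussian_prod.mul_const d⁻¹)
  have hfactor (z : E × E) : (⟪unitDirection z.1, unitDirection z.2⟫ - ⟪z.1, z.2⟫ / d) ^ 2 =
      ⟪unitDirection z.1, unitDirection z.2⟫ ^ 2 * (1 - ‖z.1‖ * ‖z.2‖ / d) ^ 2 := by
    rw [inner_eq_norm_mul_norm_mul_inner_unitDirection z.1 z.2]
    ring
  simp_rw [hfactor]
  rw [integral_inner_unitDirection_sq_mul_prod (φ := fun r s => (1 - r * s / d) ^ 2)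
    (by fun_prop) hnorm.integrable_sq, sq d, ← div_div]
  gcongr
  exact integral_one_sub_norm_mul_norm_div_sq_le

end InnerProductMoments

lemma integral_eq_zero_of_comp_eq_neg {α : Type*} [MeasurableSpace α] {μ : Measure α}
    {T : α → α} {f : α → ℝ} (hT : MeasurePreserving T μ μ) (hf : AEStronglyMeasurable f μ)
    (hfT : ∀ x, f (T x) = -f x) : ∫ x, f x ∂μ = 0 := by
  have h := integral_map hT.aemeasurable (hT.map_eq.symm ▸ hf)
  simp only [hT.map_eq, hfT, integral_neg] at h
  linarith

lemma measurePreserving_eval_prod {ι E : Type*} [Fintype ι] [MeasurableSpace E] {γ : Measure E}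
    [IsProbabilityMeasure γ] {i j : ι} (hij : i ≠ j) :
    MeasurePreserving (fun g : ι → E => (g i, g j)) (Measure.pi fun _ => γ) (γ.prod γ) := by
  have hindep := (iIndepFun_pi (μ := fun _ : ι => γ) (X := fun _ x => x)
    fun _ => aemeasurable_id).indepFun hij
  rw [indepFun_iff_map_prod_eq_prod_map_map (measurable_pi_apply i).aemeasurable
    (measurable_pi_apply j).aemeasurable] at hindep
  refine ⟨by fun_prop, hindep.trans ?_⟩
  rw [(measurePreserving_eval (fun _ : ι => γ) i).map_eq,
    (measurePreserving_eval (fun _ : ι => γ) j).map_eq]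

/-- The off-diagonal part `∑_{i ≠ j} r i * r j * h (x i) (x j)` of the quadratic form with kernel
`h` in the points `x i` weighted by `r i`, over ordered pairs. With `h` the inner product it is the
contribution of the cross terms to `‖∑ i, r i • x i‖ ^ 2`. -/
def offDiagSum {ι E : Type*} [Fintype ι] (h : E → E → ℝ) (r : ι → ℝ) (x : ι → E) : ℝ :=
  ∑ p ∈ Finset.univ.offDiag, r p.1 * r p.2 * h (x p.1) (x p.2)

section OffDiagSum

variable {ι : Type*} [Fintype ι]

lemma sum_sum_eq_sum_diag_add_sum_offDiag (f : ι → ι → ℝ) :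
    ∑ i, ∑ j, f i j = ∑ i, f i i + ∑ p ∈ Finset.univ.offDiag, f p.1 p.2 := by
  classical
  rw [← Finset.sum_product', ← Finset.diag_union_offDiag,
    Finset.sum_union (Finset.disjoint_diag_offDiag _), Finset.sum_diag]

lemma norm_sum_smul_sq_eq_add_offDiagSum {E : Type*} [NormedAddCommGroup E] [InnerProductSpace ℝ E]
    (r : ι → ℝ) (x : ι → E) :
    ‖∑ i, r i • x i‖ ^ 2 = ∑ i, r i ^ 2 * ‖x i‖ ^ 2 + offDiagSum (inner ℝ) r x := by
  simp_rw [← real_inner_self_eq_norm_sq, sum_inner, inner_sum, real_inner_smul_left,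
    real_inner_smul_right, ← mul_assoc]
  rw [sum_sum_eq_sum_diag_add_sum_offDiag, offDiagSum]
  simp_rw [sq]

lemma offDiagSum_sub {E : Type*} (h k : E → E → ℝ) (r : ι → ℝ) (x : ι → E) :
    offDiagSum (fun y z => h y z - k y z) r x = offDiagSum h r x - offDiagSum k r x := by
  simp only [offDiagSum, mul_sub, Finset.sum_sub_distrib]

lemma offDiagSum_div {E : Type*} (h : E → E → ℝ) (c : ℝ) (r : ι → ℝ) (x : ι → E) :
    offDiagSum (fun y z => h y z / c) r x = offDiagSum h r x / c := by
  simp only [offDiagSum, mul_div_assoc, Finset.sum_div]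

lemma sum_offDiag_mul_sq_le (r : ι → ℝ) :
    ∑ p ∈ Finset.univ.offDiag, (r p.1 * r p.2) ^ 2 ≤ (∑ i, r i ^ 2) ^ 2 := by
  simp_rw [sq (∑ i, r i ^ 2), Finset.sum_mul_sum, sum_sum_eq_sum_diag_add_sum_offDiag, mul_pow]
  exact le_add_of_nonneg_left (Finset.sum_nonneg fun i _ => by positivity)

variable {E : Type*} [MeasurableSpace E] {γ : Measure E} [IsProbabilityMeasure γ]

variable {h : E → E → ℝ}

lemma memLp_eval_prod (hL2 : MemLp (Function.uncurry h) 2 (γ.prod γ)) {p : ι × ι}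
    (hp : p ∈ Finset.univ.offDiag) :
    MemLp (fun g : ι → E => h (g p.1) (g p.2)) 2 (Measure.pi fun _ => γ) :=
  hL2.comp_measurePreserving (measurePreserving_eval_prod (Finset.mem_offDiag.1 hp).2.2)

lemma integral_mul_self_eval_prod (hL2 : MemLp (Function.uncurry h) 2 (γ.prod γ)) {p : ι × ι}
    (hp : p ∈ Finset.univ.offDiag) :
    ∫ g : ι → E, h (g p.1) (g p.2) * h (g p.1) (g p.2) ∂(Measure.pi fun _ => γ) =
      ∫ z, h z.1 z.2 ^ 2 ∂(γ.prod γ) := by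
  have hpair := measurePreserving_eval_prod (γ := γ) (Finset.mem_offDiag.1 hp).2.2
  simp_rw [← sq]
  rw [← hpair.map_eq, integral_map hpair.aemeasurable
    (hpair.map_eq.symm ▸ hL2.integrable_sq.aestronglyMeasurable)]

section Odd

variable [Neg E] [MeasurableNeg E] [γ.IsNegInvariant]

lemma measurePreserving_update_neg [DecidableEq ι] (i : ι) :
    MeasurePreserving (fun g : ι → E => Function.update g i (-g i))
      (Measure.pi fun _ => γ) (Measure.pi fun _ => γ) := by
  have hpi := measurePreserving_pi (fun _ : ι => γ) (fun _ : ι => γ)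
    (f := fun k x => if k = i then -x else x) fun k => by
      by_cases hk : k = i
      · simpa [hk] using! Measure.measurePreserving_neg γ
      · simpa [hk] using! MeasurePreserving.id γ
  convert hpi using 2 with g
  ext k
  by_cases hk : k = i
  · subst hk; simp
  · simp [hk]

lemma integral_mul_eval_prod_eq_zero (hodd : ∀ x y, h (-x) y = -h x y)
    (hsymm : ∀ x y, h x y = h y x) (hL2 : MemLp (Function.uncurry h) 2 (γ.prod γ)) {p q : ι × ι}
    (hp : p ∈ Finset.univ.offDiag) (hq : q ∈ Finset.univ.offDiag) (hqp : q ≠ p)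
    (hqswap : q ≠ p.swap) :
    ∫ g : ι → E, h (g p.1) (g p.2) * h (g q.1) (g q.2) ∂(Measure.pi fun _ => γ) = 0 := by
  classical
  have hodd' (x y : E) : h x (-y) = -h x y := by rw [hsymm, hodd, hsymm]
  have hmeas := (memLp_eval_prod hL2 hp).aestronglyMeasurable.mul
    (memLp_eval_prod hL2 hq).aestronglyMeasurable
  have hp' := (Finset.mem_offDiag.1 hp).2.2
  -- Some index of `p` does not occur in `q`; changing the sign of that point flips the integrand.
  by_cases hfst : p.1 ≠ q.1 ∧ p.1 ≠ q.2
  · refine integral_eq_zero_of_comp_eq_neg (measurePreserving_update_neg p.1) hmeas fun g => ?_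
    simp [hp'.symm, hfst.1.symm, hfst.2.symm, hodd]
  · have hsnd : p.2 ≠ q.1 ∧ p.2 ≠ q.2 := by
      simp only [ne_eq, Prod.ext_iff, Prod.fst_swap, Prod.snd_swap] at hqp hqswap
      grind
    refine integral_eq_zero_of_comp_eq_neg (measurePreserving_update_neg p.2) hmeas fun g => ?_
    simp [hp', hsnd.1.symm, hsnd.2.symm, hodd']

lemma sum_offDiag_mul_integral_eval_prod (hodd : ∀ x y, h (-x) y = -h x y)
    (hsymm : ∀ x y, h x y = h y x) (hL2 : MemLp (Function.uncurry h) 2 (γ.prod γ)) (r : ι → ℝ)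
    {p : ι × ι} (hp : p ∈ Finset.univ.offDiag) :
    ∑ q ∈ Finset.univ.offDiag, r q.1 * r q.2 *
        ∫ g : ι → E, h (g p.1) (g p.2) * h (g q.1) (g q.2) ∂(Measure.pi fun _ => γ) =
      2 * (r p.1 * r p.2) * ∫ z, h z.1 z.2 ^ 2 ∂(γ.prod γ) := by
  have hp' := (Finset.mem_offDiag.1 hp).2.2
  have hswap : p.swap ∈ Finset.univ.offDiag := by simpa using hp'.symm
  have hne : p ≠ p.swap := fun hpp => hp' (congrArg Prod.fst hpp)
  rw [Finset.sum_eq_add_of_mem p p.swap hp hswap hne]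
  · simp only [Prod.fst_swap, Prod.snd_swap]
    simp_rw [fun g : ι → E => hsymm (g p.2) (g p.1)]
    rw [integral_mul_self_eval_prod hL2 hp]
    ring
  · rintro q hq ⟨hqp, hqswap⟩
    rw [integral_mul_eval_prod_eq_zero hodd hsymm hL2 hp hq hqp hqswap, mul_zero]

lemma integral_offDiagSum_sq (hodd : ∀ x y, h (-x) y = -h x y)
    (hsymm : ∀ x y, h x y = h y x) (hL2 : MemLp (Function.uncurry h) 2 (γ.prod γ)) (r : ι → ℝ) :
    ∫ g, offDiagSum h r g ^ 2 ∂(Measure.pi fun _ : ι => γ) =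
      2 * (∫ z, h z.1 z.2 ^ 2 ∂(γ.prod γ)) * ∑ p ∈ Finset.univ.offDiag, (r p.1 * r p.2) ^ 2 := by
  have hint (p) (hp : p ∈ Finset.univ.offDiag) (q) (hq : q ∈ Finset.univ.offDiag) :
      Integrable (fun g : ι → E => r p.1 * r p.2 * h (g p.1) (g p.2) *
        (r q.1 * r q.2 * h (g q.1) (g q.2))) (Measure.pi fun _ => γ) :=
    ((memLp_eval_prod hL2 hp).const_mul _).integrable_mul ((memLp_eval_prod hL2 hq).const_mul _)
  simp_rw [sq (offDiagSum _ _ _), offDiagSum, Finset.sum_mul_sum]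
  rw [integral_finsetSum _ fun p hp => integrable_finsetSum _ (hint p hp), Finset.mul_sum]
  refine Finset.sum_congr rfl fun p hp => ?_
  rw [integral_finsetSum _ (hint p hp)]
  simp_rw [mul_mul_mul_comm _ (h _ _) _ (h _ _), integral_const_mul, mul_assoc (r p.1 * r p.2)]
  rw [← Finset.mul_sum, sum_offDiag_mul_integral_eval_prod hodd hsymm hL2 r hp]
  ring

lemma integral_offDiagSum_sq_le (hodd : ∀ x y, h (-x) y = -h x y)
    (hsymm : ∀ x y, h x y = h y x) (hL2 : MemLp (Function.uncurry h) 2 (γ.prod γ)) (r : ι → ℝ) :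
    ∫ g, offDiagSum h r g ^ 2 ∂(Measure.pi fun _ : ι => γ) ≤
      2 * (∫ z, h z.1 z.2 ^ 2 ∂(γ.prod γ)) * (∑ i, r i ^ 2) ^ 2 := by
  rw [integral_offDiagSum_sq hodd hsymm hL2]
  have hnonneg : 0 ≤ ∫ z, h z.1 z.2 ^ 2 ∂(γ.prod γ) :=
    integral_nonneg fun z => sq_nonneg (h z.1 z.2)
  exact mul_le_mul_of_nonneg_left (sum_offDiag_mul_sq_le r) (mul_nonneg two_pos.le hnonneg)

end Odd

lemma memLp_offDiagSum (hL2 : MemLp (Function.uncurry h) 2 (γ.prod γ)) (r : ι → ℝ) :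
    MemLp (offDiagSum h r) 2 (Measure.pi fun _ => γ) :=
  memLp_finsetSum _ fun _ hp => (memLp_eval_prod hL2 hp).const_mul _

end OffDiagSum

instance isNegInvariant_stdGaussian {E : Type*} [NormedAddCommGroup E] [InnerProductSpace ℝ E]
    [FiniteDimensional ℝ E] [MeasurableSpace E] [BorelSpace E] :
    (stdGaussian E).IsNegInvariant :=
  ⟨stdGaussian_map (LinearIsometryEquiv.neg ℝ)⟩

section CharFunPerturbation

lemma norm_charFun_map_sub_charFun_map_le {α : Type*} [MeasurableSpace α] {μ : Measure α}
    [IsProbabilityMeasure μ] {X Y : α → ℝ} (hX : AEMeasurable X μ) (hY : AEMeasurable Y μ)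
    (hXY : MemLp (fun x => X x - Y x) 2 μ) (t : ℝ) :
    ‖charFun (μ.map X) t - charFun (μ.map Y) t‖ ≤ |t| * √(∫ x, (X x - Y x) ^ 2 ∂μ) := by
  have hint {Z : α → ℝ} (hZ : AEMeasurable Z μ) :
      Integrable (fun x => Complex.exp (t * Z x * Complex.I)) μ :=
    Integrable.of_bound (by fun_prop) 1 <| ae_of_all _ fun x => by
      rw [← Complex.ofReal_mul, Complex.norm_exp_ofReal_mul_I]
  have hpoint (x : α) : ‖Complex.exp (t * X x * Complex.I) - Complex.exp (t * Y x * Complex.I)‖ ≤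
      |t| * |X x - Y x| := by
    have hfactor : Complex.exp (t * X x * Complex.I) - Complex.exp (t * Y x * Complex.I) =
        Complex.exp ((t * Y x : ℝ) * Complex.I) *
          (Complex.exp (Complex.I * (t * (X x - Y x) : ℝ)) - 1) := by
      rw [mul_sub, ← Complex.exp_add, mul_one]
      push_cast
      ring_nf
    rw [hfactor, norm_mul, Complex.norm_exp_ofReal_mul_I, one_mul, ← abs_mul]
    exact Real.norm_exp_I_mul_ofReal_sub_one_le
  have hjensen : ∫ x, |X x - Y x| ∂μ ≤ √(∫ x, (X x - Y x) ^ 2 ∂μ) := by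
    have hvar := variance_nonneg (fun x => |X x - Y x|) μ
    rw [variance_eq_sub (by simpa using! hXY.norm)] at hvar
    simp only [Pi.pow_apply, sq_abs] at hvar
    exact Real.le_sqrt_of_sq_le (by linarith)
  rw [charFun_apply_real, charFun_apply_real, integral_map hX (by fun_prop),
    integral_map hY (by fun_prop), ← integral_sub (hint hX) (hint hY)]
  calc ‖∫ x, Complex.exp (t * X x * Complex.I) - Complex.exp (t * Y x * Complex.I) ∂μ‖
      ≤ ∫ x, |t| * |X x - Y x| ∂μ := norm_integral_le_of_norm_le
        ((hXY.integrable one_le_two).abs.const_mul _) (ae_of_all _ hpoint)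
    _ = |t| * ∫ x, |X x - Y x| ∂μ := integral_const_mul _ _
    _ ≤ |t| * √(∫ x, (X x - Y x) ^ 2 ∂μ) := by gcongr

lemma tendsto_charFun_map_of_tendsto_integral_sub_sq {κ : Type*} {l : Filter κ} {α : κ → Type*}
    [∀ k, MeasurableSpace (α k)] {μ : ∀ k, Measure (α k)} [∀ k, IsProbabilityMeasure (μ k)]
    {X Y : ∀ k, α k → ℝ} (hX : ∀ k, AEMeasurable (X k) (μ k)) (hY : ∀ k, AEMeasurable (Y k) (μ k))
    (hXY : ∀ k, MemLp (fun x => X k x - Y k x) 2 (μ k))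
    (hlim : Tendsto (fun k => ∫ x, (X k x - Y k x) ^ 2 ∂(μ k)) l (𝓝 0)) {t : ℝ} {c : ℂ}
    (hc : Tendsto (fun k => charFun ((μ k).map (Y k)) t) l (𝓝 c)) :
    Tendsto (fun k => charFun ((μ k).map (X k)) t) l (𝓝 c) := by
  have hbound : Tendsto (fun k => |t| * √(∫ x, (X k x - Y k x) ^ 2 ∂(μ k))) l (𝓝 0) := by
    simpa using hlim.sqrt.const_mul |t|
  have hdiff := squeeze_zero_norm
    (fun k => norm_charFun_map_sub_charFun_map_le (hX k) (hY k) (hXY k) t) hbound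
  simpa using hc.add hdiff

end CharFunPerturbation

section ChiSquare

lemma charFun_map_norm_sq_stdGaussian {E : Type*} [NormedAddCommGroup E] [InnerProductSpace ℝ E]
    [FiniteDimensional ℝ E] [MeasurableSpace E] [BorelSpace E] (t : ℝ) :
    charFun ((stdGaussian E).map fun x =>
        (‖x‖ ^ 2 - Module.finrank ℝ E) / √(2 * Module.finrank ℝ E)) t =
      charFun ((gaussianReal 0 1).map fun x => (x ^ 2 - 1) / √2)
        ((√(Module.finrank ℝ E))⁻¹ * t) ^ Module.finrank ℝ E := by
  set d := Module.finrank ℝ E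
  have hlaw := (identDistrib_norm_sq_stdGaussian (E := E)).comp
    (u := fun s => (s - d) / √(2 * d)) (by fun_prop)
  have hsum : (fun y : Fin d → ℝ => (∑ i, y i ^ 2 - d) / √(2 * d)) =
      fun y => (√d)⁻¹ * ∑ i, (y i ^ 2 - 1) / √2 := by
    ext y
    rw [← Finset.sum_div, Finset.sum_sub_distrib, Real.sqrt_mul zero_le_two]
    simp only [Finset.sum_const, Finset.card_univ, Fintype.card_fin, nsmul_eq_mul, mul_one]
    ring
  have hindep := iIndepFun_pi (μ := fun _ : Fin d => gaussianReal 0 1)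
    (X := fun _ x => (x ^ 2 - 1) / √2) fun _ => by fun_prop
  have hmarginal (i : Fin d) : ((Measure.pi fun _ : Fin d => gaussianReal 0 1).map
      fun y => (y i ^ 2 - 1) / √2) = (gaussianReal 0 1).map fun x => (x ^ 2 - 1) / √2 := by
    conv_rhs => rw [← (measurePreserving_eval (fun _ : Fin d => gaussianReal 0 1) i).map_eq]
    rw [Measure.map_map (by fun_prop) (by fun_prop), Function.comp_def]
  have hmap := hlaw.map_eq
  simp only [Function.comp_def] at hmap
  rw [hmap, hsum, charFun_map_mul_comp (by fun_prop : Measurable _).aemeasurable,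
    hindep.charFun_map_fun_sum_eq_prod fun _ => (by fun_prop : Measurable _).aemeasurable]
  simp [hmarginal]

lemma tendsto_charFun_map_norm_sq_stdGaussian (t : ℝ) :
    Tendsto (fun d : ℕ => charFun ((stdGaussian (EuclideanSpace ℝ (Fin d))).map fun x =>
      (‖x‖ ^ 2 - d) / √(2 * d)) t) atTop (𝓝 (Complex.exp (-t ^ 2 / 2))) := by
  have hmean : ∫ x, (x ^ 2 - 1) / √2 ∂(gaussianReal 0 1) = 0 := by
    rw [integral_div, integral_sub (memLp_sq_gaussianReal.integrable one_le_two)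
      (integrable_const _), integral_sq_gaussianReal]
    simp
  have hvar : ∫ x, ((x ^ 2 - 1) / √2) ^ 2 ∂(gaussianReal 0 1) = 1 := by
    have h := variance_eq_integral (μ := gaussianReal 0 1) (X := fun x : ℝ => x ^ 2) (by fun_prop)
    rw [integral_sq_gaussianReal, variance_sq_gaussianReal] at h
    simp_rw [div_pow]
    rw [integral_div, ← h, Real.sq_sqrt zero_le_two, div_self two_ne_zero]
  refine (tendsto_charFun_inv_sqrt_mul_pow (P := gaussianReal 0 1) (by fun_prop) hmean hvar
    t).congr fun d => ?_
  simpa using (charFun_map_norm_sq_stdGaussian (E := EuclideanSpace ℝ (Fin d)) t).symm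

end ChiSquare

lemma offDiagSum_inner_eq_sub {ι E : Type*} [Fintype ι] [NormedAddCommGroup E]
    [InnerProductSpace ℝ E] (r : ι → ℝ) (x : ι → E) (c : ℝ) :
    offDiagSum (inner ℝ) r x =
      ‖∑ i, r i • x i‖ ^ 2 - c * ∑ i, r i ^ 2 - ∑ i, r i ^ 2 * (‖x i‖ ^ 2 - c) := by
  rw [norm_sum_smul_sq_eq_add_offDiagSum, Finset.mul_sum]
  simp only [mul_sub, Finset.sum_sub_distrib, mul_comm c]
  ring

section FixedWeights

variable {ι E : Type*} [Fintype ι] [NormedAddCommGroup E] [InnerProductSpace ℝ E]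
  [FiniteDimensional ℝ E] [MeasurableSpace E] [BorelSpace E]

lemma stdGaussian_pi_map_sum_smul (r : ι → ℝ) :
    (Measure.pi fun _ : ι => stdGaussian E).map (fun g => ∑ i, r i • g i) =
      (stdGaussian E).map fun x => √(∑ i, r i ^ 2) • x := by
  have := Measure.isProbabilityMeasure_map (μ := Measure.pi fun _ : ι => stdGaussian E)
    (f := fun g => ∑ i, r i • g i) (by fun_prop : Measurable _).aemeasurable
  have := Measure.isProbabilityMeasure_map (μ := stdGaussian E)
    (f := fun x => √(∑ i, r i ^ 2) • x) (by fun_prop)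
  have hindep := iIndepFun_pi (μ := fun _ : ι => stdGaussian E) (X := fun i x => r i • x)
    fun _ => by fun_prop
  have hmarginal (i : ι) : (Measure.pi fun _ : ι => stdGaussian E).map (fun g => r i • g i) =
      (stdGaussian E).map fun x => r i • x := by
    conv_rhs => rw [← (measurePreserving_eval (fun _ : ι => stdGaussian E) i).map_eq]
    rw [Measure.map_map (by fun_prop) (by fun_prop), Function.comp_def]
  refine Measure.ext_of_charFun (funext fun t => ?_)
  rw [hindep.charFun_map_fun_sum_eq_prod fun _ => (by fun_prop : Measurable _).aemeasurable,
    Finset.prod_apply]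
  simp_rw [hmarginal, charFun_map_smul, charFun_stdGaussian, norm_smul, ← Complex.exp_sum]
  congr 1
  rw [← Finset.sum_div, Finset.sum_neg_distrib]
  simp only [← Complex.ofReal_pow, ← Complex.ofReal_sum, mul_pow, Real.norm_eq_abs, sq_abs]
  rw [Real.sq_sqrt (Finset.sum_nonneg fun _ _ => sq_nonneg _), Finset.sum_mul]

lemma stdGaussian_pi_map_norm_sum_smul_sq_sub_div (r : ι → ℝ) (b c : ℝ) :
    (Measure.pi fun _ : ι => stdGaussian E).map
        (fun g => (‖∑ i, r i • g i‖ ^ 2 - c * ∑ i, r i ^ 2) / b) =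
      (stdGaussian E).map fun x => (∑ i, r i ^ 2) * (‖x‖ ^ 2 - c) / b := by
  have hcomp : (fun g : ι → E => (‖∑ i, r i • g i‖ ^ 2 - c * ∑ i, r i ^ 2) / b) =
      (fun y => (‖y‖ ^ 2 - c * ∑ i, r i ^ 2) / b) ∘ fun g => ∑ i, r i • g i := rfl
  rw [hcomp, ← Measure.map_map (by fun_prop) (by fun_prop), stdGaussian_pi_map_sum_smul,
    Measure.map_map (by fun_prop) (by fun_prop)]
  congr 1
  ext x
  simp only [Function.comp_apply, norm_smul, mul_pow, Real.norm_eq_abs, sq_abs]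
  rw [Real.sq_sqrt (Finset.sum_nonneg fun _ _ => sq_nonneg _)]
  ring

lemma memLp_norm_sq_sub_finrank_stdGaussian :
    MemLp (fun x : E => ‖x‖ ^ 2 - Module.finrank ℝ E) 2 (stdGaussian E) :=
  memLp_norm_sq_stdGaussian.sub (memLp_const _)

lemma memLp_sum_mul_norm_sq_sub_finrank (r : ι → ℝ) :
    MemLp (fun g : ι → E => ∑ i, r i ^ 2 * (‖g i‖ ^ 2 - Module.finrank ℝ E)) 2
      (Measure.pi fun _ => stdGaussian E) :=
  memLp_finsetSum _ fun i _ => (memLp_norm_sq_sub_finrank_stdGaussian.comp_measurePreserving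
    (measurePreserving_eval (fun _ : ι => stdGaussian E) i)).const_mul _

lemma integral_sum_mul_norm_sq_sub_finrank_sq (r : ι → ℝ) :
    ∫ g : ι → E, (∑ i, r i ^ 2 * (‖g i‖ ^ 2 - Module.finrank ℝ E)) ^ 2
        ∂(Measure.pi fun _ => stdGaussian E) = 2 * Module.finrank ℝ E * ∑ i, r i ^ 4 := by
  have hsummand (i : ι) : MemLp (fun x : E => r i ^ 2 * (‖x‖ ^ 2 - Module.finrank ℝ E)) 2
      (stdGaussian E) := memLp_norm_sq_sub_finrank_stdGaussian.const_mul _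
  have hmean : ∫ g : ι → E, ∑ i, r i ^ 2 * (‖g i‖ ^ 2 - Module.finrank ℝ E)
      ∂(Measure.pi fun _ => stdGaussian E) = 0 := by
    rw [integral_finsetSum _ fun i _ => integrable_comp_eval (μ := fun _ : ι => stdGaussian E)
      (f := fun x => r i ^ 2 * (‖x‖ ^ 2 - Module.finrank ℝ E)) ((hsummand i).integrable one_le_two)]
    refine Finset.sum_eq_zero fun i _ => ?_
    rw [integral_comp_eval (μ := fun _ : ι => stdGaussian E)
      (f := fun x => r i ^ 2 * (‖x‖ ^ 2 - Module.finrank ℝ E)) (by fun_prop), integral_const_mul,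
      integral_sub (memLp_norm_sq_stdGaussian.integrable one_le_two) (integrable_const _),
      integral_norm_sq_stdGaussian]
    simp
  have hvar := variance_sum_pi hsummand
  rw [Finset.sum_fn, variance_of_integral_eq_zero (by fun_prop : Measurable _).aemeasurable
    hmean] at hvar
  rw [hvar, Finset.mul_sum]
  refine Finset.sum_congr rfl fun i _ => ?_
  rw [variance_const_mul, variance_sub_const (by fun_prop), variance_norm_sq_stdGaussian]
  ring

lemma memLp_offDiagSum_unitDirection (r : ι → ℝ) :
    MemLp (fun g : ι → E => offDiagSum (inner ℝ) r fun i => unitDirection (g i)) 2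
      (Measure.pi fun _ => stdGaussian E) :=
  memLp_offDiagSum (h := fun x y => ⟪unitDirection x, unitDirection y⟫)
    memLp_inner_unitDirection_stdGaussian_prod r

lemma memLp_offDiagSum_inner (r : ι → ℝ) :
    MemLp (fun g : ι → E => offDiagSum (inner ℝ) r g) 2 (Measure.pi fun _ => stdGaussian E) :=
  memLp_offDiagSum memLp_inner_stdGaussian_prod r

variable [Nontrivial E]

lemma integral_norm_sq_sub_finrank_div_sqrt_sq :
    ∫ x : E, ((‖x‖ ^ 2 - Module.finrank ℝ E) / √(2 * Module.finrank ℝ E)) ^ 2 ∂(stdGaussian E) =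
      1 := by
  have hE : (0 : ℝ) < Module.finrank ℝ E := by exact_mod_cast Module.finrank_pos
  have hvar := variance_eq_integral (μ := stdGaussian E) (X := fun x => ‖x‖ ^ 2) (by fun_prop)
  rw [integral_norm_sq_stdGaussian, variance_norm_sq_stdGaussian] at hvar
  simp_rw [div_pow]
  rw [integral_div, ← hvar, Real.sq_sqrt (by positivity), div_self (by positivity)]

lemma integral_offDiagSum_unitDirection_sq_le (r : ι → ℝ) :
    ∫ g : ι → E, offDiagSum (inner ℝ) r (fun i => unitDirection (g i)) ^ 2
        ∂(Measure.pi fun _ => stdGaussian E) ≤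
      2 / Module.finrank ℝ E * (∑ i, r i ^ 2) ^ 2 := by
  have h := integral_offDiagSum_sq_le (γ := stdGaussian E)
    (h := fun x y => ⟪unitDirection x, unitDirection y⟫) (fun x y => by simp [unitDirection_neg])
    (fun x y => real_inner_comm _ _) memLp_inner_unitDirection_stdGaussian_prod r
  rwa [integral_inner_unitDirection_sq_stdGaussian_prod, mul_one_div] at h

lemma integral_offDiagSum_unitDirection_sub_sq_le (r : ι → ℝ) :
    ∫ g : ι → E, (offDiagSum (inner ℝ) r (fun i => unitDirection (g i)) -
        offDiagSum (inner ℝ) r g / Module.finrank ℝ E) ^ 2 ∂(Measure.pi fun _ => stdGaussian E) ≤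
      8 / (Module.finrank ℝ E : ℝ) ^ 2 * (∑ i, r i ^ 2) ^ 2 := by
  have h := integral_offDiagSum_sq_le (γ := stdGaussian E)
    (h := fun x y => ⟪unitDirection x, unitDirection y⟫ - ⟪x, y⟫ / Module.finrank ℝ E)
    (fun x y => by simp only [unitDirection_neg, inner_neg_left]; ring)
    (fun x y => by simp only [real_inner_comm])
    (memLp_inner_unitDirection_stdGaussian_prod.sub
      (memLp_inner_stdGaussian_prod.mul_const _)) r
  simp_rw [offDiagSum_sub, offDiagSum_div] at h
  refine h.trans ?_
  calc _ ≤ 2 * (4 / (Module.finrank ℝ E : ℝ) ^ 2) * (∑ i, r i ^ 2) ^ 2 := by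
        gcongr; exact integral_inner_unitDirection_sub_inner_sq_le
    _ = _ := by ring

end FixedWeights

lemma sqrt_two_mul_sq_div {s x : ℝ} (hs : 0 ≤ s) (hx : 0 < x) :
    √(2 * s ^ 2 / x) = s * √(2 * x) / x := by
  rw [Real.sqrt_eq_iff_mul_self_eq (by positivity) (by positivity), ← sq, div_pow, mul_pow,
    Real.sq_sqrt (by positivity)]
  field_simp

section WeightArrays

variable {ι : ℕ → Type*} [∀ d, Fintype (ι d)] {r : ∀ d, ι d → ℝ} {s : ℕ → ℝ}

lemma eventually_pos_of_tendsto_sum_sq_div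
    (hr : Tendsto (fun d => (∑ i, r d i ^ 2) / s d) atTop (𝓝 1)) : ∀ᶠ d in atTop, 0 < s d := by
  filter_upwards [hr.eventually_const_lt one_pos] with d hd
  exact (div_pos_iff.1 hd).elim And.right fun h =>
    absurd h.1 (Finset.sum_nonneg fun _ _ => sq_nonneg _).not_gt

lemma tendsto_charFun_map_norm_sum_smul_sq
    (hr : Tendsto (fun d => (∑ i, r d i ^ 2) / s d) atTop (𝓝 1)) (t : ℝ) :
    Tendsto (fun d => charFun ((Measure.pi fun _ : ι d =>
        stdGaussian (EuclideanSpace ℝ (Fin d))).map fun g =>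
          (‖∑ i, r d i • g i‖ ^ 2 - d * ∑ i, r d i ^ 2) / (s d * √(2 * d))) t)
      atTop (𝓝 (Complex.exp (-t ^ 2 / 2))) := by
  let Z (d : ℕ) (x : EuclideanSpace ℝ (Fin d)) : ℝ := (‖x‖ ^ 2 - d) / √(2 * d)
  have hZ (d : ℕ) : MemLp (Z d) 2 (stdGaussian _) := by
    simpa [Z, div_eq_mul_inv] using (memLp_norm_sq_sub_finrank_stdGaussian
      (E := EuclideanSpace ℝ (Fin d))).mul_const (√(2 * d))⁻¹
  have hsub (d : ℕ) (x : EuclideanSpace ℝ (Fin d)) :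
      (∑ i, r d i ^ 2) / s d * Z d x - Z d x = ((∑ i, r d i ^ 2) / s d - 1) * Z d x := by ring
  have hlimit : Tendsto (fun d => charFun ((stdGaussian (EuclideanSpace ℝ (Fin d))).map fun x =>
      (∑ i, r d i ^ 2) / s d * Z d x) t) atTop (𝓝 (Complex.exp (-t ^ 2 / 2))) := by
    refine tendsto_charFun_map_of_tendsto_integral_sub_sq
      (fun d => ((hZ d).const_mul _).aestronglyMeasurable.aemeasurable)
      (fun d => (hZ d).aestronglyMeasurable.aemeasurable)
      (fun d => by simpa only [hsub] using (hZ d).const_mul _) ?_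
      (tendsto_charFun_map_norm_sq_stdGaussian t)
    have hzero : Tendsto (fun d => ((∑ i, r d i ^ 2) / s d - 1) ^ 2) atTop (𝓝 0) := by
      simpa using (hr.sub_const 1).pow 2
    refine hzero.congr' ?_
    filter_upwards [eventually_gt_atTop 0] with d hd
    have : Nonempty (Fin d) := ⟨⟨0, hd⟩⟩
    have hnorm := integral_norm_sq_sub_finrank_div_sqrt_sq (E := EuclideanSpace ℝ (Fin d))
    simp only [finrank_euclideanSpace_fin] at hnorm
    simp_rw [hsub, mul_pow, integral_const_mul]
    rw [hnorm, mul_one]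
  refine hlimit.congr fun d => ?_
  rw [stdGaussian_pi_map_norm_sum_smul_sq_sub_div]
  congr 3
  ext x
  ring

lemma tendsto_charFun_map_offDiagSum_inner
    (hr : Tendsto (fun d => (∑ i, r d i ^ 2) / s d) atTop (𝓝 1))
    (hr4 : Tendsto (fun d => (∑ i, r d i ^ 4) / s d ^ 2) atTop (𝓝 0)) (t : ℝ) :
    Tendsto (fun d => charFun ((Measure.pi fun _ : ι d =>
        stdGaussian (EuclideanSpace ℝ (Fin d))).map fun g =>
          offDiagSum (inner ℝ) (r d) g / (s d * √(2 * d))) t)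
      atTop (𝓝 (Complex.exp (-t ^ 2 / 2))) := by
  have hsub (d : ℕ) (g : ι d → EuclideanSpace ℝ (Fin d)) :
      offDiagSum (inner ℝ) (r d) g / (s d * √(2 * d)) -
          (‖∑ i, r d i • g i‖ ^ 2 - d * ∑ i, r d i ^ 2) / (s d * √(2 * d)) =
        (∑ i, r d i ^ 2 * (‖g i‖ ^ 2 - d)) * (-(s d * √(2 * d))⁻¹) := by
    rw [offDiagSum_inner_eq_sub _ _ (d : ℝ)]
    ring
  refine tendsto_charFun_map_of_tendsto_integral_sub_sq
    (X := fun d g => offDiagSum (inner ℝ) (r d) g / (s d * √(2 * d)))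
    (fun d => ((memLp_offDiagSum_inner (r d)).mul_const (s d * √(2 * d))⁻¹).aemeasurable)
    (fun d => (by fun_prop : Measurable _).aemeasurable) (fun d => ?_) (hr4.congr' ?_)
    (tendsto_charFun_map_norm_sum_smul_sq hr t)
  · simp_rw [hsub]
    simpa using (memLp_sum_mul_norm_sq_sub_finrank (E := EuclideanSpace ℝ (Fin d)) (r d)).mul_const
      (-(s d * √(2 * d))⁻¹)
  · filter_upwards [eventually_pos_of_tendsto_sum_sq_div hr, eventually_gt_atTop 0] with d hs hd
    have hmoment := integral_sum_mul_norm_sq_sub_finrank_sq (E := EuclideanSpace ℝ (Fin d)) (r d)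
    simp only [finrank_euclideanSpace_fin] at hmoment
    simp_rw [hsub, mul_pow, integral_mul_const]
    rw [hmoment, neg_sq, inv_pow, mul_pow, Real.sq_sqrt (by positivity)]
    field_simp

lemma tendsto_charFun_map_offDiagSum_unitDirection
    (hr : Tendsto (fun d => (∑ i, r d i ^ 2) / s d) atTop (𝓝 1))
    (hr4 : Tendsto (fun d => (∑ i, r d i ^ 4) / s d ^ 2) atTop (𝓝 0)) (t : ℝ) :
    Tendsto (fun d => charFun ((Measure.pi fun _ : ι d =>
        stdGaussian (EuclideanSpace ℝ (Fin d))).map fun g =>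
          offDiagSum (inner ℝ) (r d) (fun i => unitDirection (g i)) / √(2 * s d ^ 2 / d)) t)
      atTop (𝓝 (Complex.exp (-t ^ 2 / 2))) := by
  refine tendsto_charFun_map_of_tendsto_integral_sub_sq
    (X := fun d g => offDiagSum (inner ℝ) (r d) (fun i => unitDirection (g i)) /
      √(2 * s d ^ 2 / d))
    (Y := fun d g => offDiagSum (inner ℝ) (r d) g / (s d * √(2 * d)))
    (fun d => ((memLp_offDiagSum_unitDirection (r d)).mul_const
      (√(2 * s d ^ 2 / d))⁻¹).aemeasurable)
    (fun d => ((memLp_offDiagSum_inner (r d)).mul_const (s d * √(2 * d))⁻¹).aemeasurable)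
    (fun d => ((memLp_offDiagSum_unitDirection (r d)).mul_const _).sub
      ((memLp_offDiagSum_inner (r d)).mul_const _)) ?_
    (tendsto_charFun_map_offDiagSum_inner hr hr4 t)
  have hbound : Tendsto (fun d : ℕ => 4 * ((∑ i, r d i ^ 2) / s d) ^ 2 / d) atTop (𝓝 0) :=
    ((hr.pow 2).const_mul 4).div_atTop tendsto_natCast_atTop_atTop
  refine squeeze_zero' (Eventually.of_forall fun d => integral_nonneg fun g => sq_nonneg _) ?_
    hbound
  filter_upwards [eventually_pos_of_tendsto_sum_sq_div hr, eventually_gt_atTop 0] with d hs hd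
  have : Nonempty (Fin d) := ⟨⟨0, hd⟩⟩
  have hmoment := integral_offDiagSum_unitDirection_sub_sq_le (E := EuclideanSpace ℝ (Fin d)) (r d)
  simp only [finrank_euclideanSpace_fin] at hmoment
  have hsub (g : ι d → EuclideanSpace ℝ (Fin d)) :
      offDiagSum (inner ℝ) (r d) (fun i => unitDirection (g i)) / √(2 * s d ^ 2 / d) -
          offDiagSum (inner ℝ) (r d) g / (s d * √(2 * d)) =
        (offDiagSum (inner ℝ) (r d) (fun i => unitDirection (g i)) -
          offDiagSum (inner ℝ) (r d) g / d) * (d / (s d * √(2 * d))) := by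
    rw [sqrt_two_mul_sq_div hs.le (Nat.cast_pos.2 hd)]
    field_simp
  simp_rw [hsub, mul_pow, integral_mul_const]
  calc _ ≤ 8 / (d : ℝ) ^ 2 * (∑ i, r d i ^ 2) ^ 2 * (d / (s d * √(2 * d))) ^ 2 := by gcongr
    _ = 4 * ((∑ i, r d i ^ 2) / s d) ^ 2 / d := by
      rw [div_pow (d : ℝ), mul_pow, Real.sq_sqrt (by positivity)]
      field_simp
      ring

lemma tendsto_charFun_map_offDiagSum_unitDirection_one {a : ℕ → ℝ}
    (hr : Tendsto (fun d => (∑ i, r d i ^ 2) / s d) atTop (𝓝 1))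
    (ha : Tendsto (fun d => s d ^ 2 / (d * a d ^ 2)) atTop (𝓝 0)) (t : ℝ) :
    Tendsto (fun d => charFun ((Measure.pi fun _ : ι d =>
        stdGaussian (EuclideanSpace ℝ (Fin d))).map fun g =>
          offDiagSum (inner ℝ) (r d) (fun i => unitDirection (g i)) / a d) t) atTop (𝓝 1) := by
  have hL2 (d : ℕ) : MemLp (fun g : ι d → EuclideanSpace ℝ (Fin d) =>
      offDiagSum (inner ℝ) (r d) (fun i => unitDirection (g i)) / a d) 2
      (Measure.pi fun _ => stdGaussian _) := (memLp_offDiagSum_unitDirection (r d)).mul_const _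
  refine tendsto_charFun_map_of_tendsto_integral_sub_sq (Y := fun _ _ => 0)
    (fun d => (hL2 d).aemeasurable) (fun d => aemeasurable_const)
    (fun d => by simpa only [sub_zero] using hL2 d) ?_ (by simp)
  have hbound : Tendsto (fun d => 2 * ((∑ i, r d i ^ 2) / s d) ^ 2 * (s d ^ 2 / (d * a d ^ 2)))
      atTop (𝓝 0) := by
    simpa using ((hr.pow 2).const_mul 2).mul ha
  refine squeeze_zero' (Eventually.of_forall fun d => integral_nonneg fun g => sq_nonneg _) ?_
    hbound
  filter_upwards [eventually_pos_of_tendsto_sum_sq_div hr, eventually_gt_atTop 0] with d hs hd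
  have : Nonempty (Fin d) := ⟨⟨0, hd⟩⟩
  have hmoment := integral_offDiagSum_unitDirection_sq_le (E := EuclideanSpace ℝ (Fin d)) (r d)
  simp only [finrank_euclideanSpace_fin] at hmoment
  simp_rw [sub_zero, div_pow, integral_div]
  calc _ ≤ 2 / d * (∑ i, r d i ^ 2) ^ 2 / a d ^ 2 := by gcongr
    _ = 2 * ((∑ i, r d i ^ 2) ^ 2 / s d ^ 2) * (s d ^ 2 / (d * a d ^ 2)) := by field_simp

end WeightArrays

lemma tendsto_div_natCast_zero_of_tendsto_sum_div {b : ℕ → ℝ} {c : ℝ}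
    (h : Tendsto (fun n : ℕ => (∑ i ∈ Finset.range n, b i) / n) atTop (𝓝 c)) :
    Tendsto (fun n : ℕ => b n / ((n : ℝ) + 1)) atTop (𝓝 0) := by
  have hdiff := ((tendsto_add_atTop_iff_nat 1).2 h).sub
    (h.mul (tendsto_natCast_div_add_atTop (1 : ℝ)))
  rw [mul_one, sub_self] at hdiff
  refine hdiff.congr' ?_
  filter_upwards [eventually_gt_atTop 0] with n hn
  rw [Finset.sum_range_succ]
  push_cast
  field_simp
  ring

lemma tendsto_sum_sq_div_sq_of_tendsto_sum_div {b : ℕ → ℝ} (hb : ∀ i, 0 ≤ b i) {c : ℝ}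
    (h : Tendsto (fun n : ℕ => (∑ i ∈ Finset.range n, b i) / n) atTop (𝓝 c)) :
    Tendsto (fun n : ℕ => (∑ i ∈ Finset.range n, b i ^ 2) / (n : ℝ) ^ 2) atTop (𝓝 0) := by
  have hterm : (fun i => b i ^ 2) =o[atTop] fun i => ((i : ℝ) + 1) * (b i + 1) := by
    have hlittle : b =o[atTop] fun i => (i : ℝ) + 1 :=
      (Asymptotics.isLittleO_iff_tendsto fun i hi => absurd hi (by positivity)).2
        (tendsto_div_natCast_zero_of_tendsto_sum_div h)
    have hbig : b =O[atTop] fun i => b i + 1 := Asymptotics.IsBigO.of_norm_le fun i => by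
      rw [Real.norm_of_nonneg (hb i)]
      linarith
    simpa only [sq] using hlittle.mul_isBigO hbig
  have hdiverge : Tendsto (fun n => ∑ i ∈ Finset.range n, ((i : ℝ) + 1) * (b i + 1)) atTop
      atTop := by
    refine tendsto_atTop_mono (fun n => ?_) tendsto_natCast_atTop_atTop
    simpa using Finset.card_nsmul_le_sum (Finset.range n) _ (1 : ℝ) fun i _ =>
      one_le_mul_of_one_le_of_one_le (by simp) (le_add_of_nonneg_left (hb i))
  have hquadratic : (fun n => ∑ i ∈ Finset.range n, ((i : ℝ) + 1) * (b i + 1)) =O[atTop]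
      fun n => (n : ℝ) ^ 2 := by
    have haverage := (Asymptotics.isBigO_refl (fun n : ℕ => (n : ℝ) ^ 2) atTop).mul
      ((h.add_const 1).isBigO_one ℝ)
    simp only [mul_one] at haverage
    refine (Asymptotics.IsBigO.of_norm_le fun n => ?_).trans haverage
    rw [Real.norm_of_nonneg (Finset.sum_nonneg fun i _ =>
      mul_nonneg (by positivity) (by linarith [hb i]))]
    calc ∑ i ∈ Finset.range n, ((i : ℝ) + 1) * (b i + 1)
        ≤ ∑ i ∈ Finset.range n, (n : ℝ) * (b i + 1) := by
          refine Finset.sum_le_sum fun i hi => mul_le_mul_of_nonneg_right ?_ (by linarith [hb i])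
          exact_mod_cast Finset.mem_range.1 hi
      _ = (n : ℝ) ^ 2 * ((∑ i ∈ Finset.range n, b i) / n + 1) := by
          rw [← Finset.mul_sum, Finset.sum_add_distrib]
          rcases n.eq_zero_or_pos with rfl | hn
          · simp
          · rw [Finset.sum_const, Finset.card_range, nsmul_one]
            field_simp
  have hsum := (hterm.sum_range (fun i => mul_nonneg (by positivity) (by linarith [hb i]))
    hdiverge).trans_isBigO hquadratic
  exact hsum.tendsto_div_nhds_zero

lemma charFun_map_eq_integral_cexp {α : Type*} [MeasurableSpace α] {μ : Measure α} {f : α → ℝ}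
    (hf : Measurable f) (t : ℝ) :
    charFun (μ.map f) t = ∫ x, Complex.exp (t * f x * Complex.I) ∂μ := by
  rw [charFun_apply_real, integral_map hf.aemeasurable (by fun_prop)]

lemma measurable_charFun_map {α β : Type*} [MeasurableSpace α] [MeasurableSpace β]
    {ν : Measure β} [SFinite ν] {F : α → β → ℝ} (hF : Measurable fun z : α × β => F z.1 z.2)
    (t : ℝ) : Measurable fun x => charFun (ν.map (F x)) t := by
  have hsection (x : α) := charFun_map_eq_integral_cexp (μ := ν) (f := F x)
    (hF.comp measurable_prodMk_left) t
  simp_rw [hsection]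
  exact (StronglyMeasurable.integral_prod_right'
    (f := fun z : α × β => Complex.exp (t * F z.1 z.2 * Complex.I))
    (by fun_prop : Measurable _).stronglyMeasurable).measurable

section Conditioning

variable {Ω : Type*} [MeasurableSpace Ω] {P : Measure Ω} [IsProbabilityMeasure P]

lemma charFun_map_prodMk_eq_integral {α β : Type*} [MeasurableSpace α] [MeasurableSpace β]
    {X : Ω → α} {Y : Ω → β} (hX : Measurable X) (hY : Measurable Y) (hXY : IndepFun X Y P)
    {F : α → β → ℝ} (hF : Measurable fun z : α × β => F z.1 z.2) (t : ℝ) :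
    charFun (P.map fun ω => F (X ω) (Y ω)) t =
      ∫ ω, charFun ((P.map Y).map (F (X ω))) t ∂P := by
  have := Measure.isProbabilityMeasure_map (μ := P) hX.aemeasurable
  have := Measure.isProbabilityMeasure_map (μ := P) hY.aemeasurable
  have hint : Integrable (fun z : α × β => Complex.exp (t * F z.1 z.2 * Complex.I))
      ((P.map X).prod (P.map Y)) :=
    Integrable.of_bound (by fun_prop) 1 (ae_of_all _ fun z => by
      rw [← Complex.ofReal_mul, Complex.norm_exp_ofReal_mul_I])
  have hlaw : P.map (fun ω => F (X ω) (Y ω)) =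
      ((P.map X).prod (P.map Y)).map fun z => F z.1 z.2 := by
    rw [← (indepFun_iff_map_prod_eq_prod_map_map hX.aemeasurable hY.aemeasurable).1 hXY,
      Measure.map_map hF (hX.prodMk hY), Function.comp_def]
  have hsection (x : α) := charFun_map_eq_integral_cexp (μ := P.map Y) (f := F x)
    (hF.comp measurable_prodMk_left) t
  simp_rw [hsection]
  rw [hlaw, charFun_apply_real, integral_map hF.aemeasurable (by fun_prop), integral_prod _ hint,
    integral_map hX.aemeasurable hint.integral_prod_left.aestronglyMeasurable]

lemma tendsto_charFun_map_of_ae_tendsto {κ : Type*} {l : Filter κ} [l.IsCountablyGenerated]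
    {α β : κ → Type*} [∀ k, MeasurableSpace (α k)] [∀ k, MeasurableSpace (β k)]
    {X : ∀ k, Ω → α k} {Y : ∀ k, Ω → β k} (hX : ∀ k, Measurable (X k)) (hY : ∀ k, Measurable (Y k))
    (hXY : ∀ᶠ k in l, IndepFun (X k) (Y k) P) {F : ∀ k, α k → β k → ℝ}
    (hF : ∀ k, Measurable fun z : α k × β k => F k z.1 z.2) {t : ℝ} {c : ℂ}
    (h : ∀ᵐ ω ∂P, Tendsto (fun k => charFun ((P.map (Y k)).map (F k (X k ω))) t) l (𝓝 c)) :
    Tendsto (fun k => charFun (P.map fun ω => F k (X k ω) (Y k ω)) t) l (𝓝 c) := by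
  have hlim := tendsto_integral_filter_of_dominated_convergence (μ := P) (fun _ => (1 : ℝ))
    (Eventually.of_forall fun k => ?_) (Eventually.of_forall fun k => ae_of_all P fun ω => ?_)
    (integrable_const 1) h
  · simp only [integral_const, probReal_univ, one_smul] at hlim
    refine hlim.congr' ?_
    filter_upwards [hXY] with k hk
    exact (charFun_map_prodMk_eq_integral (hX k) (hY k) hk (hF k) t).symm
  · have := Measure.isProbabilityMeasure_map (μ := P) (hY k).aemeasurable
    exact ((measurable_charFun_map (hF k) t).comp (hX k)).aestronglyMeasurable
  · have := Measure.isProbabilityMeasure_map (μ := P) (hY k).aemeasurable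
    have := Measure.isProbabilityMeasure_map (μ := P.map (Y k)) (f := F k (X k ω))
      ((hF k).comp measurable_prodMk_left).aemeasurable
    exact norm_charFun_le_one _

end Conditioning

section SlowVariation

variable {f : ℝ → ℝ}

lemma tendsto_volume_le_abs_add_sub (hf : Measurable f)
    (h : ∀ u, Tendsto (fun x => f (x + u) - f x) atTop (𝓝 0)) {x : ℕ → ℝ}
    (hx : Tendsto x atTop atTop) (a b : ℝ) {ε : ℝ} (hε : 0 < ε) :
    Tendsto (fun k => volume {v ∈ Set.Icc a b | ε ≤ |f (x k + v) - f (x k)|}) atTop (𝓝 0) := by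
  have hmeasure : TendstoInMeasure (volume.restrict (Set.Icc a b))
      (fun k v => f (x k + v) - f (x k)) atTop (fun _ => (0 : ℝ)) :=
    tendstoInMeasure_of_tendsto_ae
      (fun k => ((hf.comp (measurable_const_add _)).sub_const _).aestronglyMeasurable)
      (ae_of_all _ fun v => (h v).comp hx)
  refine (tendstoInMeasure_iff_norm.1 hmeasure ε hε).congr fun k => ?_
  rw [Measure.restrict_apply' measurableSet_Icc, Set.inter_comm]
  simp only [sub_zero, Real.norm_eq_abs]
  rfl

lemma tendstoUniformlyOn_add_sub (hf : Measurable f)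
    (h : ∀ u, Tendsto (fun x => f (x + u) - f x) atTop (𝓝 0)) {c : ℝ} (hc : 0 < c) :
    TendstoUniformlyOn (fun x u => f (x + u) - f x) 0 atTop (Set.Icc 0 c) := by
  rw [Metric.tendstoUniformlyOn_iff]
  by_contra! hcon
  obtain ⟨ε, hε, hcon⟩ := hcon
  simp only [Pi.zero_apply, dist_zero_left, Real.norm_eq_abs] at hcon
  choose x hx u hu hxu using fun k : ℕ => (frequently_atTop.1 hcon) k
  have hx_top : Tendsto x atTop atTop := tendsto_atTop_mono hx tendsto_natCast_atTop_atTop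
  have hxu_top : Tendsto (fun k => x k + u k) atTop atTop :=
    tendsto_atTop_mono (fun k => le_add_of_nonneg_right (hu k).1) hx_top
  have hsmall {y : ℕ → ℝ} (hy : Tendsto y atTop atTop) :=
    (tendsto_volume_le_abs_add_sub hf h hy 0 (2 * c) (half_pos hε)).eventually_lt_const
      (ENNReal.ofReal_pos.2 (half_pos hc))
  obtain ⟨k, hA, hB⟩ := ((hsmall hx_top).and (hsmall hxu_top)).exists
  set A := {v ∈ Set.Icc (0 : ℝ) (2 * c) | ε / 2 ≤ |f (x k + v) - f (x k)|}
  set B := {v ∈ Set.Icc (0 : ℝ) (2 * c) | ε / 2 ≤ |f (x k + u k + v) - f (x k + u k)|}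
  -- For `v` in `[c, 2c]`, one of the increments from `x` and from `x + u` to `x + v` is large.
  have hcover : Set.Icc c (2 * c) ⊆ A ∪ (fun v => v + -u k) ⁻¹' B := by
    rintro v ⟨hcv, hvc⟩
    obtain ⟨hu0, huc⟩ := hu k
    by_contra hnot
    simp only [Set.mem_union, Set.mem_preimage, A, B, Set.mem_ofPred_eq, Set.mem_Icc, not_or,
      not_and, not_le] at hnot
    have hAv := hnot.1 ⟨by linarith, hvc⟩
    have hBv := hnot.2 ⟨by linarith, by linarith⟩
    rw [show x k + u k + (v + -u k) = x k + v by ring] at hBv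
    have htriangle := abs_sub (f (x k + v) - f (x k)) (f (x k + v) - f (x k + u k))
    rw [sub_sub_sub_cancel_left] at htriangle
    linarith [hxu k]
  have hvolume : ENNReal.ofReal c < ENNReal.ofReal (c / 2) + ENNReal.ofReal (c / 2) :=
    calc ENNReal.ofReal c = volume (Set.Icc c (2 * c)) := by rw [Real.volume_Icc]; congr 1; ring
      _ ≤ volume A + volume ((fun v => v + -u k) ⁻¹' B) :=
          (measure_mono hcover).trans (measure_union_le _ _)
      _ = volume A + volume B := by rw [measure_preimage_add_right]
      _ < _ := ENNReal.add_lt_add hA hB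
  rw [← ENNReal.ofReal_add (by positivity) (by positivity), add_halves] at hvolume
  exact hvolume.false

lemma eventually_abs_le_mul_of_tendsto_add_sub (hf : Measurable f)
    (h : ∀ u, Tendsto (fun x => f (x + u) - f x) atTop (𝓝 0)) {η : ℝ} (hη : 0 < η) :
    ∀ᶠ x in atTop, |f x| ≤ η * x := by
  obtain ⟨X, hX⟩ := eventually_atTop.1
    (Metric.tendstoUniformlyOn_iff.1 (tendstoUniformlyOn_add_sub hf h one_pos) _ (half_pos hη))
  simp only [Pi.zero_apply, dist_zero_left, Real.norm_eq_abs] at hX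
  have hsteps (k : ℕ) : |f (X + k) - f X| ≤ k * (η / 2) := by
    induction k with
    | zero => simp
    | succ k ih =>
      have hstep := hX (X + k) (by simp) 1 (by simp)
      have htriangle := abs_add_le (f (X + k + 1) - f (X + k)) (f (X + k) - f X)
      rw [sub_add_sub_cancel] at htriangle
      push_cast
      rw [← add_assoc]
      linarith
  filter_upwards [eventually_ge_atTop X,
    eventually_ge_atTop ((|f X| + (1 - X) * (η / 2)) / (η / 2))] with x hxX hx
  rw [div_le_iff₀ (by positivity)] at hx
  have hfloor_le := Nat.floor_le (sub_nonneg.2 hxX)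
  have hlt_floor := Nat.lt_floor_add_one (x - X)
  set k := ⌊x - X⌋₊
  have hlast := hX (X + k) (by simp) (x - (X + k)) ⟨by linarith, by linarith⟩
  rw [add_sub_cancel] at hlast
  have htriangle := abs_add_three (f x - f (X + k)) (f (X + k) - f X) (f X)
  simp only [sub_add_sub_cancel, sub_add_cancel] at htriangle
  nlinarith [hsteps k]

end SlowVariation

namespace IsSlowlyVarying

variable {L : ℝ → ℝ}

lemma tendsto_log_comp_exp_add_sub (hL : IsSlowlyVarying L) (u : ℝ) :
    Tendsto (fun x => Real.log (L (Real.exp (x + u))) - Real.log (L (Real.exp x))) atTop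
      (𝓝 0) := by
  have hpos : ∀ᶠ x in atTop, 0 < L (Real.exp x) :=
    Real.tendsto_exp_atTop.eventually hL.eventually_pos
  have hratio := ((hL.tendsto_ratio (Real.exp u) (Real.exp_pos u)).comp
    Real.tendsto_exp_atTop).log one_ne_zero
  rw [Real.log_one] at hratio
  refine hratio.congr' ?_
  filter_upwards [hpos, (tendsto_atTop_add_const_right atTop u tendsto_id).eventually hpos]
    with x hx hxu
  simp only [Function.comp, id] at hxu ⊢
  rw [← Real.exp_add, add_comm u x, Real.log_div hxu.ne' hx.ne']

lemma eventually_rpow_neg_le_and_le_rpow (hL : IsSlowlyVarying L) {η : ℝ} (hη : 0 < η) :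
    ∀ᶠ x in atTop, x ^ (-η) ≤ L x ∧ L x ≤ x ^ η := by
  have hlog := Real.tendsto_log_atTop.eventually (eventually_abs_le_mul_of_tendsto_add_sub
    (Real.measurable_log.comp (hL.measurable.comp Real.measurable_exp))
    hL.tendsto_log_comp_exp_add_sub hη)
  filter_upwards [hlog, hL.eventually_pos, eventually_gt_atTop 0] with x hx hLx hx0
  simp only [Function.comp_apply] at hx
  rw [Real.exp_log hx0, abs_le] at hx
  rw [Real.rpow_def_of_pos hx0, Real.rpow_def_of_pos hx0, ← Real.le_log_iff_exp_le hLx,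
    ← Real.log_le_iff_le_exp hLx]
  constructor <;> linarith

variable {κ : Type*} {l : Filter κ} {x D : κ → ℝ} {β q : ℝ}

lemma tendsto_rpow_mul_div_sqrt (hL : IsSlowlyVarying L) (hx : Tendsto x l atTop)
    (hq : q < 2 - 2 * β) (hD0 : ∀ᶠ k in l, 0 < D k) (hD : ∀ᶠ k in l, D k ≤ x k ^ q) :
    Tendsto (fun k => x k ^ β * L (x k) / √(2 * x k ^ 2 / D k)) l (𝓝 0) := by
  obtain ⟨η, hη, hqη⟩ : ∃ η > 0, q = 2 - 2 * β - 4 * η :=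
    ⟨(2 - 2 * β - q) / 4, by linarith, by ring⟩
  refine squeeze_zero' (g := fun k => x k ^ (-η)) ?_ ?_ ((tendsto_rpow_neg_atTop hη).comp hx)
  · filter_upwards [hx.eventually hL.eventually_pos, hx.eventually_gt_atTop 0] with k hLk hk
    positivity
  · filter_upwards [hx.eventually (hL.eventually_rpow_neg_le_and_le_rpow hη), hD0, hD,
      hx.eventually_gt_atTop 0] with k ⟨_, hLk⟩ hDk0 hDk hk
    have hsqrt : x k ^ (β + 2 * η) ≤ √(2 * x k ^ 2 / D k) := by
      refine Real.le_sqrt_of_sq_le ?_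
      rw [le_div_iff₀ hDk0]
      calc (x k ^ (β + 2 * η)) ^ 2 * D k ≤ (x k ^ (β + 2 * η)) ^ 2 * x k ^ q := by gcongr
        _ = x k ^ 2 := by
          rw [← Real.rpow_mul_natCast hk.le, ← Real.rpow_add hk, ← Real.rpow_natCast, hqη]
          push_cast
          ring_nf
        _ ≤ 2 * x k ^ 2 := by linarith [sq_nonneg (x k)]
    rw [div_le_iff₀ (by positivity)]
    calc x k ^ β * L (x k) ≤ x k ^ β * x k ^ η := by gcongr
      _ = x k ^ (-η) * x k ^ (β + 2 * η) := by
        rw [← Real.rpow_add hk, ← Real.rpow_add hk]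
        ring_nf
      _ ≤ _ := by gcongr

lemma tendsto_sq_div_mul_rpow_mul_sq (hL : IsSlowlyVarying L) (hx : Tendsto x l atTop)
    (hq : 2 - 2 * β < q) (hD : ∀ᶠ k in l, x k ^ q ≤ D k) :
    Tendsto (fun k => x k ^ 2 / (D k * (x k ^ β * L (x k)) ^ 2)) l (𝓝 0) := by
  obtain ⟨η, hη, hqη⟩ : ∃ η > 0, q = 2 - 2 * β + 3 * η :=
    ⟨(q - (2 - 2 * β)) / 3, by linarith, by ring⟩
  have hbound : ∀ᶠ k in l, 0 < D k ∧
      x k ^ 2 / (D k * (x k ^ β * L (x k)) ^ 2) ≤ x k ^ (-η) := by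
    filter_upwards [hx.eventually (hL.eventually_rpow_neg_le_and_le_rpow hη), hD,
      hx.eventually_gt_atTop 0] with k ⟨hLk, _⟩ hDk hk
    have hL0 : 0 < L (x k) := (Real.rpow_pos_of_pos hk _).trans_le hLk
    have hD0 : 0 < D k := (Real.rpow_pos_of_pos hk _).trans_le hDk
    refine ⟨hD0, ?_⟩
    rw [div_le_iff₀ (by positivity)]
    calc x k ^ 2 = x k ^ (-η) * (x k ^ q * (x k ^ β * x k ^ (-η)) ^ 2) := by
          rw [← Real.rpow_add hk, ← Real.rpow_mul_natCast hk.le, ← Real.rpow_add hk,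
            ← Real.rpow_add hk, ← Real.rpow_natCast, hqη]
          push_cast
          ring_nf
      _ ≤ _ := by gcongr
  refine squeeze_zero' ?_ (hbound.mono fun k hk => hk.2) ((tendsto_rpow_neg_atTop hη).comp hx)
  filter_upwards [hbound] with k hk
  have := hk.1
  positivity

end IsSlowlyVarying

section Exponents

variable {κ : Type*} {l : Filter κ} {x D : κ → ℝ} {θ δ : ℝ}

lemma exists_lt_eventually_le_rpow (hθ : 0 < θ) (hδ : 0 < δ) (hD : ∀ᶠ k in l, 0 ≤ D k)
    (h : ∀ᶠ k in l, D k ^ (θ⁻¹ + δ) < x k) : ∃ q < θ, ∀ᶠ k in l, D k ≤ x k ^ q := by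
  refine ⟨(θ⁻¹ + δ)⁻¹, inv_lt_of_inv_lt₀ hθ (by linarith), ?_⟩
  filter_upwards [hD, h] with k hDk hk
  exact (Real.le_rpow_inv_iff_of_pos hDk ((Real.rpow_nonneg hDk _).trans hk.le)
    (by positivity)).2 hk.le

lemma exists_gt_eventually_rpow_le (hδ : 0 < δ) (hx : Tendsto x l atTop)
    (hD : ∀ᶠ k in l, 1 ≤ D k) (h : ∀ᶠ k in l, x k < D k ^ (θ⁻¹ - δ)) :
    ∃ q > θ, ∀ᶠ k in l, x k ^ q ≤ D k := by
  rcases le_or_gt (θ⁻¹ - δ) 0 with hneg | hpos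
  · refine ⟨θ + 1, by linarith, ?_⟩
    filter_upwards [hx.eventually_ge_atTop 1, hD, h] with k hxk hDk hk
    linarith [Real.rpow_le_one_of_one_le_of_nonpos hDk hneg]
  · refine ⟨(θ⁻¹ - δ)⁻¹, lt_inv_of_lt_inv₀ hpos (by linarith), ?_⟩
    filter_upwards [hx.eventually_ge_atTop 0, hD, h] with k hxk hDk hk
    exact (Real.rpow_inv_le_iff_of_pos hxk (by linarith) hpos).2 hk.le

end Exponents

section ConvergenceInDistribution

variable {Ω Ω' : Type*} [MeasurableSpace Ω] [MeasurableSpace Ω'] {P : Measure Ω}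
  [IsProbabilityMeasure P] {P' : Measure Ω'} [IsProbabilityMeasure P']

lemma tendstoInDistribution_of_tendsto_charFun {X : ℕ → Ω → ℝ} {Z : Ω' → ℝ}
    (hX : ∀ i, AEMeasurable (X i) P) (hZ : AEMeasurable Z P')
    (h : ∀ t, Tendsto (fun i => charFun (P.map (X i)) t) atTop (𝓝 (charFun (P'.map Z) t))) :
    TendstoInDistribution X atTop Z (fun _ => P) P' where
  forall_aemeasurable := hX
  aemeasurable_limit := hZ
  tendsto := ProbabilityMeasure.tendsto_iff_tendsto_charFun.2 h

variable {κ : Type*} {l : Filter κ}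

lemma tendstoInMeasure_of_tendstoInDistribution_const {E : Type*} [PseudoMetricSpace E]
    [MeasurableSpace E] [BorelSpace E] {X : κ → Ω → E} {c : E}
    (h : TendstoInDistribution X l (fun _ : Ω' => c) (fun _ => P) P') :
    TendstoInMeasure P X l fun _ => c := by
  rw [tendstoInMeasure_iff_dist]
  intro ε hε
  have hclosed : IsClosed {x | ε ≤ dist x c} :=
    isClosed_le continuous_const (continuous_id.dist continuous_const)
  have hlimsup := ProbabilityMeasure.limsup_measure_closed_le_of_tendsto h.tendsto hclosed
  simp only [ProbabilityMeasure.coe_mk] at hlimsup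
  rw [Measure.map_const, Measure.smul_apply, Measure.dirac_apply' _ hclosed.measurableSet,
    Set.indicator_of_notMem (by simpa using hε), smul_zero] at hlimsup
  simp_rw [fun k => Measure.map_apply_of_aemeasurable (h.forall_aemeasurable k)
    hclosed.measurableSet] at hlimsup
  exact tendsto_of_le_liminf_of_limsup_le bot_le hlimsup

lemma tendstoInMeasure_mul_of_tendstoInDistribution [l.IsCountablyGenerated] {X : κ → Ω → ℝ}
    {Z : Ω' → ℝ} (h : TendstoInDistribution X l Z (fun _ => P) P') {c : κ → ℝ}
    (hc : Tendsto c l (𝓝 0)) : TendstoInMeasure P (fun k ω => X k ω * c k) l 0 := by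
  have hc_measure : TendstoInMeasure P (fun k _ => c k) l fun _ => (0 : ℝ) := by
    refine tendstoInMeasure_iff_dist.2 fun ε hε => tendsto_const_nhds.congr' ?_
    filter_upwards [Metric.tendsto_nhds.1 hc ε hε] with k hk
    have hlt : ¬ε ≤ |c k| := by simpa using hk
    simp [hlt]
  have hprod := h.continuous_comp_prodMk_of_tendstoInMeasure_const
    (g := fun z : ℝ × ℝ => z.1 * z.2) (by fun_prop) hc_measure fun _ => aemeasurable_const
  simp only [mul_zero] at hprod
  exact tendstoInMeasure_of_tendstoInDistribution_const hprod

end ConvergenceInDistribution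

namespace IsRotationInvariantModel

variable {Ω : Type*} [MeasurableSpace Ω] {P : Measure Ω} {R : ℕ → Ω → ℝ}
  {U : (d : ℕ) → ℕ → Ω → EuclideanSpace ℝ (Fin d)}

lemma ae_tendsto_sum_radial_sq_div (hM : IsRotationInvariantModel P R U) :
    ∀ᵐ ω ∂P, Tendsto (fun m : ℕ => (∑ i ∈ Finset.range m, R i ω ^ 2) / m) atTop (𝓝 1) := by
  have hint : Integrable (fun ω => R 0 ω ^ 2) P :=
    not_imp_comm.1 integral_undef (by simp [hM.radial_second_moment])
  have hlaw := strong_law_ae_real (μ := P) (fun i ω => R i ω ^ 2) hint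
    (fun i j hij => (hM.radial_iIndep.indepFun hij).comp (measurable_id.pow_const 2)
      (measurable_id.pow_const 2))
    (fun i => (hM.radial_identDistrib i).comp (measurable_id.pow_const 2))
  rwa [hM.radial_second_moment] at hlaw

lemma measurable_radials (hM : IsRotationInvariantModel P R U) (m : ℕ) :
    Measurable fun ω (i : Fin m) => R i ω :=
  measurable_pi_lambda _ fun i => hM.measurable_radial i

lemma measurable_directions (hM : IsRotationInvariantModel P R U) (d m : ℕ) :
    Measurable fun ω (i : Fin m) => U d i ω := by
  rcases d.eq_zero_or_pos with rfl | hd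
  · exact measurable_of_subsingleton_codomain _
  · exact measurable_pi_lambda _ fun i => hM.measurable_direction d hd i

lemma measurable_walk (hM : IsRotationInvariantModel P R U) (d m : ℕ) :
    Measurable (walk R U d m) := by
  rcases d.eq_zero_or_pos with rfl | hd
  · exact measurable_of_subsingleton_codomain _
  · exact Finset.measurable_fun_sum _ fun i _ =>
      (hM.measurable_radial i).smul (hM.measurable_direction d hd i)

lemma measurable_norm_walk_sq_sub_div (hM : IsRotationInvariantModel P R U) (d m : ℕ) (c : ℝ) :
    Measurable fun ω => (‖walk R U d m ω‖ ^ 2 - m) / c :=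
  (((hM.measurable_walk d m).norm.pow_const 2).sub_const _).div_const _

lemma measurable_offDiagSum (hM : IsRotationInvariantModel P R U) (d m : ℕ) :
    Measurable fun ω => offDiagSum (inner ℝ) (fun i : Fin m => R i ω) fun i => U d i ω := by
  have hR := measurable_pi_iff.1 (hM.measurable_radials m)
  have hU := measurable_pi_iff.1 (hM.measurable_directions d m)
  unfold offDiagSum
  fun_prop

lemma indepFun_radials_directions (hM : IsRotationInvariantModel P R U) {d : ℕ} (hd : 0 < d)
    (m : ℕ) : IndepFun (fun ω (i : Fin m) => R i ω) (fun ω (i : Fin m) => U d i ω) P :=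
  (hM.radial_indep_direction d hd).comp (φ := fun (x : ℕ → ℝ) (i : Fin m) => x i)
    (ψ := fun (x : ℕ → EuclideanSpace ℝ (Fin d)) (i : Fin m) => x i) (by fun_prop) (by fun_prop)

lemma ae_norm_walk_sq_eq (hM : IsRotationInvariantModel P R U) {d : ℕ} (hd : 0 < d) (m : ℕ) :
    ∀ᵐ ω ∂P, ‖walk R U d m ω‖ ^ 2 = ∑ i ∈ Finset.range m, R i ω ^ 2 +
      offDiagSum (inner ℝ) (fun i : Fin m => R i ω) fun i => U d i ω := by
  have hunit (i : ℕ) : ∀ᵐ ω ∂P, ‖U d i ω‖ = 1 := by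
    have : Nonempty (Fin d) := ⟨⟨0, hd⟩⟩
    refine ae_of_ae_map (p := fun x => ‖x‖ = 1) (hM.measurable_direction d hd i).aemeasurable ?_
    rw [hM.direction_uniform d hd, ← stdGaussian_map_unitDirection_eq_uniformUnitSphere hd,
      ae_map_iff (by fun_prop) (measurableSet_eq_fun (by fun_prop) (by fun_prop))]
    exact ae_norm_unitDirection_eq_one
  filter_upwards [ae_all_iff.2 hunit] with ω hω
  rw [walk, ← Fin.sum_univ_eq_sum_range (fun i => R i ω • U d i ω) m,
    norm_sum_smul_sq_eq_add_offDiagSum, ← Fin.sum_univ_eq_sum_range (fun i => R i ω ^ 2) m]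
  simp only [hω, one_pow, mul_one]

lemma eventually_ae_norm_walk_sq_sub_div_eq (hM : IsRotationInvariantModel P R U) (n : ℕ → ℕ)
    (a : ℕ → ℝ) :
    ∀ᶠ d in atTop, ∀ᵐ ω ∂P, (‖walk R U d (n d) ω‖ ^ 2 - n d) / a d =
      (∑ i ∈ Finset.range (n d), R i ω ^ 2 - n d) / a d +
        offDiagSum (inner ℝ) (fun i : Fin (n d) => R i ω) (fun i => U d i ω) / a d := by
  filter_upwards [eventually_gt_atTop 0] with d hd
  filter_upwards [hM.ae_norm_walk_sq_eq hd (n d)] with ω hω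
  rw [hω]
  ring

variable [IsProbabilityMeasure P]

lemma map_directions_eq (hM : IsRotationInvariantModel P R U) {d : ℕ} (hd : 0 < d) (m : ℕ) :
    P.map (fun ω (i : Fin m) => U d i ω) =
      (Measure.pi fun _ : Fin m => stdGaussian (EuclideanSpace ℝ (Fin d))).map
        fun g i => unitDirection (g i) := by
  have : Nonempty (Fin d) := ⟨⟨0, hd⟩⟩
  have hunit := stdGaussian_map_unitDirection_eq_uniformUnitSphere hd
  have : IsProbabilityMeasure (uniformUnitSphere d) :=
    hunit ▸ Measure.isProbabilityMeasure_map measurable_unitDirection.aemeasurable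
  have hindep : iIndepFun (fun i : Fin m => U d i) P :=
    (hM.direction_iIndep d hd).precomp (g := fun i : Fin m => (i : ℕ)) Fin.val_injective
  have hpi := (iIndepFun_iff_map_fun_eq_pi_map (ι := Fin m)
    fun i => (hM.measurable_direction d hd i).aemeasurable).1 hindep
  simp_rw [hpi, hM.direction_uniform d hd]
  exact (measurePreserving_pi (fun _ : Fin m => stdGaussian (EuclideanSpace ℝ (Fin d)))
    (fun _ => uniformUnitSphere d) fun _ => ⟨measurable_unitDirection, hunit⟩).map_eq.symm

lemma tendsto_charFun_map_offDiagSum (hM : IsRotationInvariantModel P R U) (n : ℕ → ℕ)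
    (a : ℕ → ℝ) {t : ℝ} {c : ℂ}
    (h : ∀ᵐ ω ∂P, Tendsto (fun d => charFun ((Measure.pi fun _ : Fin (n d) =>
      stdGaussian (EuclideanSpace ℝ (Fin d))).map fun g =>
        offDiagSum (inner ℝ) (fun i : Fin (n d) => R i ω) (fun i => unitDirection (g i)) / a d) t)
      atTop (𝓝 c)) :
    Tendsto (fun d => charFun (P.map fun ω => offDiagSum (inner ℝ) (fun i : Fin (n d) => R i ω)
      (fun i => U d i ω) / a d) t) atTop (𝓝 c) := by
  have hF (d : ℕ) : Measurable fun z : (Fin (n d) → ℝ) × (Fin (n d) → EuclideanSpace ℝ (Fin d)) =>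
      offDiagSum (inner ℝ) z.1 z.2 / a d := by
    unfold offDiagSum
    fun_prop
  refine tendsto_charFun_map_of_ae_tendsto (F := fun d r x => offDiagSum (inner ℝ) r x / a d)
    (fun d => hM.measurable_radials (n d))
    (fun d => hM.measurable_directions d (n d))
    ((eventually_gt_atTop 0).mono fun d hd => hM.indepFun_radials_directions hd (n d)) hF ?_
  filter_upwards [h] with ω hω
  refine hω.congr' ?_
  filter_upwards [eventually_gt_atTop 0] with d hd
  have hsection : Measurable fun x => offDiagSum (inner ℝ) (fun i : Fin (n d) => R i ω) x / a d :=
    (hF d).comp measurable_prodMk_left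
  have hunit : Measurable fun (g : Fin (n d) → EuclideanSpace ℝ (Fin d)) i => unitDirection (g i) :=
    measurable_pi_lambda _ fun i => measurable_unitDirection.comp (measurable_pi_apply i)
  rw [hM.map_directions_eq hd, Measure.map_map hsection hunit]
  rfl

variable {n : ℕ → ℕ}

lemma tendstoInDistribution_offDiagSum_div_sqrt (hM : IsRotationInvariantModel P R U)
    (hn : Tendsto n atTop atTop) :
    TendstoInDistribution (fun d ω => offDiagSum (inner ℝ) (fun i : Fin (n d) => R i ω)
      (fun i => U d i ω) / √(2 * (n d : ℝ) ^ 2 / d)) atTop id (fun _ => P) (gaussianReal 0 1) := by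
  refine tendstoInDistribution_of_tendsto_charFun
    (fun d => ((hM.measurable_offDiagSum d (n d)).div_const _).aemeasurable) aemeasurable_id
    fun t => ?_
  have hlimit : charFun ((gaussianReal 0 1).map id) t = Complex.exp (-t ^ 2 / 2) := by
    simp [charFun_gaussianReal, neg_div]
  rw [hlimit]
  refine hM.tendsto_charFun_map_offDiagSum n _ ?_
  filter_upwards [hM.ae_tendsto_sum_radial_sq_div] with ω hω
  refine tendsto_charFun_map_offDiagSum_unitDirection (s := fun d => (n d : ℝ)) ?_ ?_ t
  · simpa only [Fin.sum_univ_eq_sum_range (fun i => R i ω ^ 2), Function.comp_def] using hω.comp hn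
  · have hfourth :=
      (tendsto_sum_sq_div_sq_of_tendsto_sum_div (fun i => sq_nonneg (R i ω)) hω).comp hn
    simpa only [Fin.sum_univ_eq_sum_range (fun i => R i ω ^ 4), ← pow_mul, Nat.reduceMul,
      Function.comp_def] using hfourth

lemma tendstoInMeasure_offDiagSum_div (hM : IsRotationInvariantModel P R U)
    (hn : Tendsto n atTop atTop) {a : ℕ → ℝ}
    (ha : Tendsto (fun d : ℕ => (n d : ℝ) ^ 2 / (d * a d ^ 2)) atTop (𝓝 0)) :
    TendstoInMeasure P (fun d ω => offDiagSum (inner ℝ) (fun i : Fin (n d) => R i ω)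
      (fun i => U d i ω) / a d) atTop fun _ => 0 := by
  refine tendstoInMeasure_of_tendstoInDistribution_const (tendstoInDistribution_of_tendsto_charFun
    (P' := P) (fun d => ((hM.measurable_offDiagSum d (n d)).div_const _).aemeasurable)
    aemeasurable_const fun t => ?_)
  have hlimit : charFun (P.map fun _ => (0 : ℝ)) t = 1 := by simp
  rw [hlimit]
  refine hM.tendsto_charFun_map_offDiagSum n _ ?_
  filter_upwards [hM.ae_tendsto_sum_radial_sq_div] with ω hω
  refine tendsto_charFun_map_offDiagSum_unitDirection_one (s := fun d => (n d : ℝ)) ?_ ha t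
  simpa only [Fin.sum_univ_eq_sum_range (fun i => R i ω ^ 2), Function.comp_def] using hω.comp hn

theorem tendstoInDistribution_walk_of_radial_negligible (hM : IsRotationInvariantModel P R U)
    (hn : Tendsto n atTop atTop)
    (hradial : TendstoInMeasure P (fun (d : ℕ) ω =>
      (∑ i ∈ Finset.range (n d), R i ω ^ 2 - n d) / √(2 * (n d : ℝ) ^ 2 / d)) atTop 0) :
    TendstoInDistribution (fun (d : ℕ) ω =>
      (‖walk R U d (n d) ω‖ ^ 2 - n d) / √(2 * (n d : ℝ) ^ 2 / d))
      atTop id (fun _ => P) (gaussianReal 0 1) := by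
  refine tendstoInDistribution_of_tendstoInMeasure_sub _ _
    (hM.tendstoInDistribution_offDiagSum_div_sqrt hn) (hradial.congr' ?_ (ae_eq_refl _))
    fun d => (hM.measurable_norm_walk_sq_sub_div d (n d) _).aemeasurable
  filter_upwards [hM.eventually_ae_norm_walk_sq_sub_div_eq n fun d => √(2 * (n d : ℝ) ^ 2 / d)]
    with d hd
  filter_upwards [hd] with ω hω
  simp only [Pi.sub_apply, hω, add_sub_cancel_right]

theorem tendstoInDistribution_walk_of_tendstoInDistribution_radial {Ω' : Type*}
    [MeasurableSpace Ω'] {P' : Measure Ω'} [IsProbabilityMeasure P'] {ζ : Ω' → ℝ}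
    (hM : IsRotationInvariantModel P R U) (hn : Tendsto n atTop atTop) {a : ℕ → ℝ}
    (ha : Tendsto (fun d : ℕ => (n d : ℝ) ^ 2 / (d * a d ^ 2)) atTop (𝓝 0))
    (hradial : TendstoInDistribution (fun (d : ℕ) ω =>
      (∑ i ∈ Finset.range (n d), R i ω ^ 2 - n d) / a d) atTop ζ (fun _ => P) P') :
    TendstoInDistribution (fun (d : ℕ) ω => (‖walk R U d (n d) ω‖ ^ 2 - n d) / a d)
      atTop ζ (fun _ => P) P' := by
  refine tendstoInDistribution_of_tendstoInMeasure_sub _ _ hradial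
    ((hM.tendstoInMeasure_offDiagSum_div hn ha).congr' ?_ (ae_eq_refl _))
    fun d => (hM.measurable_norm_walk_sq_sub_div d (n d) _).aemeasurable
  filter_upwards [hM.eventually_ae_norm_walk_sq_sub_div_eq n a] with d hd
  filter_upwards [hd] with ω hω
  simp only [Pi.sub_apply, hω, add_sub_cancel_left]

end IsRotationInvariantModel

theorem mainTheorem10_general
    {Ω Ω' : Type*} [MeasurableSpace Ω] [MeasurableSpace Ω']
    (P : Measure Ω) [IsProbabilityMeasure P] (P' : Measure Ω') [IsProbabilityMeasure P']
    (R : ℕ → Ω → ℝ) (U : (d : ℕ) → ℕ → Ω → EuclideanSpace ℝ (Fin d))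
    (hmodel : IsRotationInvariantModel P R U)
    (α : ℝ) (hα : 1 < α) (L : ℝ → ℝ) (hL : IsSlowlyVarying L) (ζ : Ω' → ℝ)
    (hattr : TendstoInDistribution
      (fun (m : ℕ) ω => (∑ i ∈ Finset.range m, (R i ω) ^ 2 - (m : ℝ)) /
        ((m : ℝ) ^ (1 / α) * L m))
      atTop ζ (fun _ => P) P')
    (n : ℕ → ℕ) (hn : Tendsto n atTop atTop) :
    ((∃ δ : ℝ, 0 < δ ∧
        ∀ᶠ d : ℕ in atTop, (d : ℝ) ^ (α / (2 * α - 2) + δ) < (n d : ℝ)) →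
      TendstoInDistribution
        (fun (d : ℕ) ω => (‖walk R U d (n d) ω‖ ^ 2 - (n d : ℝ)) /
          Real.sqrt (2 * (n d : ℝ) ^ 2 / (d : ℝ)))
        atTop (id : ℝ → ℝ) (fun _ => P) (gaussianReal 0 1)) ∧
    ((∃ δ : ℝ, 0 < δ ∧
        ∀ᶠ d : ℕ in atTop, (n d : ℝ) < (d : ℝ) ^ (α / (2 * α - 2) - δ)) →
      TendstoInDistribution
        (fun (d : ℕ) ω => (‖walk R U d (n d) ω‖ ^ 2 - (n d : ℝ)) /
          ((n d : ℝ) ^ (1 / α) * L (n d)))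
        atTop ζ (fun _ => P) P') := by
  have hn' : Tendsto (fun d => (n d : ℝ)) atTop atTop := tendsto_natCast_atTop_atTop.comp hn
  have hradial : TendstoInDistribution (fun (d : ℕ) ω =>
      (∑ i ∈ Finset.range (n d), R i ω ^ 2 - n d) / ((n d : ℝ) ^ (1 / α) * L (n d)))
      atTop ζ (fun _ => P) P' :=
    ⟨fun d => hattr.forall_aemeasurable (n d), hattr.aemeasurable_limit, hattr.tendsto.comp hn⟩
  have hθ : 0 < 2 - 2 * (1 / α) := by
    linarith [(div_lt_one (by linarith : 0 < α)).2 hα]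
  have hexponent : α / (2 * α - 2) = (2 - 2 * (1 / α))⁻¹ := by
    have : 2 * α - 2 ≠ 0 := by linarith
    field_simp
  rw [hexponent]
  refine ⟨fun ⟨δ, hδ, h⟩ => ?_, fun ⟨δ, hδ, h⟩ => ?_⟩
  · obtain ⟨q, hq, hdq⟩ := exists_lt_eventually_le_rpow hθ hδ (.of_forall fun d => d.cast_nonneg) h
    refine hmodel.tendstoInDistribution_walk_of_radial_negligible hn
      ((tendstoInMeasure_mul_of_tendstoInDistribution hradial (hL.tendsto_rpow_mul_div_sqrt hn' hq
        (tendsto_natCast_atTop_atTop.eventually_gt_atTop 0) hdq)).congr' ?_ (ae_eq_refl _))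
    filter_upwards [hn'.eventually hL.eventually_pos, hn'.eventually_gt_atTop 0] with d hLd hnd
    have hscale : (n d : ℝ) ^ (1 / α) * L (n d) ≠ 0 := by positivity
    exact .of_forall fun ω => div_mul_div_cancel₀ hscale
  · obtain ⟨q, hq, hqd⟩ := exists_gt_eventually_rpow_le hδ hn'
      (tendsto_natCast_atTop_atTop.eventually_ge_atTop 1) h
    exact hmodel.tendstoInDistribution_walk_of_tendstoInDistribution_radial hn
      (hL.tendsto_sq_div_mul_rpow_mul_sq hn' hq hqd) hradial

theorem mainTheorem10
    {Ω Ω' : Type*} [MeasurableSpace Ω] [MeasurableSpace Ω']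
    (P : Measure Ω) [IsProbabilityMeasure P] (P' : Measure Ω') [IsProbabilityMeasure P']
    (R : ℕ → Ω → ℝ) (U : (d : ℕ) → ℕ → Ω → EuclideanSpace ℝ (Fin d))
    (hmodel : IsRotationInvariantModel P R U)
    (α : ℝ) (hα : α ∈ Set.Ioo (1 : ℝ) 2)
    (L : ℝ → ℝ) (hL : IsSlowlyVarying L)
    (ζ : Ω' → ℝ) (hζ : Measurable ζ) (hζ_stable : IsSpectrallyPositiveStable α (P'.map ζ))
    (hζ_int : Integrable ζ P') (hζ_mean : ∫ ω, ζ ω ∂P' = 0)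
    (hattr : TendstoInDistribution
      (fun (m : ℕ) ω => (∑ i ∈ Finset.range m, (R i ω) ^ 2 - (m : ℝ)) /
        ((m : ℝ) ^ (1 / α) * L m))
      atTop ζ (fun _ => P) P')
    (n : ℕ → ℕ) (hn : Tendsto n atTop atTop) :
    ((∃ δ : ℝ, 0 < δ ∧
        ∀ᶠ d : ℕ in atTop, (d : ℝ) ^ (α / (2 * α - 2) + δ) < (n d : ℝ)) →
      TendstoInDistribution
        (fun (d : ℕ) ω => (‖walk R U d (n d) ω‖ ^ 2 - (n d : ℝ)) /
          Real.sqrt (2 * (n d : ℝ) ^ 2 / (d : ℝ)))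
        atTop (id : ℝ → ℝ) (fun _ => P) (gaussianReal 0 1)) ∧
    ((∃ δ : ℝ, 0 < δ ∧
        ∀ᶠ d : ℕ in atTop, (n d : ℝ) < (d : ℝ) ^ (α / (2 * α - 2) - δ)) →
      TendstoInDistribution
        (fun (d : ℕ) ω => (‖walk R U d (n d) ω‖ ^ 2 - (n d : ℝ)) /
          ((n d : ℝ) ^ (1 / α) * L (n d)))
        atTop ζ (fun _ => P) P') :=
  mainTheorem10_general P P' R U hmodel α hα.1 L hL ζ hattr n hn
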